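/- For integers $n,r\ge 0$ let $\binom{n}{\downarrow r}=\sum_{i=0}^{r}\binom{n}{i}$. A set $S$ of vertices of a finite simple undirected graph $G$ \emph{dominates} the vertices that belong to $S$ or have a neighbour in $S$. There is a deterministic algorithm which, given a graph $G$ on $n$ vertices (by its adjacency matrix) and integers $k,t\ge 0$ (in binary), computes the number of sets $S\subseteq V(G)$ with $|S|=k$ that dominate at least $t$ vertices of $G$, in time $O^*\!\left(\binom{n}{\downarrow \lfloor t/2\rfloor}\right)$. That is, there are a program of a deterministic random access machine with logarithmic (bit) cost and a polynomial $q$ such that, for all $n,k,t\ge 0$ and all graphs $G$ on $n$ vertices, the program halts with the correct answer after at most $$q(L)\cdot\sum_{i=0}^{\lfloor t/2\rfloor}\binom{n}{i}$$ time, where $L$ is the bit length of the input: $n^2$ plus the lengths of the binary representations of $n$, $k$ and $t$. -/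

import Mathlib

/-! ### A random access machine with logarithmic (bit) cost

The memory consists of arrays of natural numbers; the name of an array is a constant of the program
text (so a program uses finitely many arrays), while the index into it is computed.  Numbers may be
arbitrarily large, but every operation is charged for the bit length of the numbers that it handles:
linearly for addition, subtraction, reading, writing and testing, and at the price of the schoolbook
methods for multiplication and division. -/

namespace RAM

/-- A memory state: `σ a i` is the content of cell `i` of array `a`. -/
abbrev State : Type := ℕ → ℕ → ℕ

/-- Expressions.  `sub` is truncated subtraction; division by `0` gives `0`. -/
inductive Expr : Type
  | const (c : ℕ)
  | read (a : ℕ) (i : Expr)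
  | add (x y : Expr)
  | sub (x y : Expr)
  | mul (x y : Expr)
  | div (x y : Expr)
  | mod (x y : Expr)

/-- The value of an expression. -/
def Expr.val (σ : State) : Expr → ℕ
  | .const c => c
  | .read a i => σ a (i.val σ)
  | .add x y => x.val σ + y.val σ
  | .sub x y => x.val σ - y.val σ
  | .mul x y => x.val σ * y.val σ
  | .div x y => x.val σ / y.val σ
  | .mod x y => x.val σ % y.val σ

/-- The time needed to evaluate an expression (`Nat.size m` is the bit length of `m`). -/
def Expr.cost (σ : State) : Expr → ℕ
  | .const c => 1 + c.size
  | .read a i => i.cost σ + (1 + (i.val σ).size + (σ a (i.val σ)).size)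
  | .add x y => x.cost σ + y.cost σ + (1 + (x.val σ).size + (y.val σ).size)
  | .sub x y => x.cost σ + y.cost σ + (1 + (x.val σ).size + (y.val σ).size)
  | .mul x y => x.cost σ + y.cost σ + (1 + (x.val σ).size) * (1 + (y.val σ).size)
  | .div x y => x.cost σ + y.cost σ + (1 + (x.val σ).size) * (1 + (y.val σ).size)
  | .mod x y => x.cost σ + y.cost σ + (1 + (x.val σ).size) * (1 + (y.val σ).size)

/-- The state after writing `v` into cell `i` of array `a`. -/
def State.set (σ : State) (a i v : ℕ) : State :=
  fun b j => if b = a ∧ j = i then v else σ b j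

/-- Programs. -/
inductive Prog : Type
  | skip
  | write (a : ℕ) (i e : Expr)
  | seq (p q : Prog)
  | ite (e : Expr) (p q : Prog)
  | loop (e : Expr) (p : Prog)

/-- `Exec p σ T τ`: started in the state `σ`, the program `p` halts after time exactly `T` in the
state `τ`.  A test `e` succeeds when its value is nonzero; `loop e p` repeats `p` while `e`
succeeds. -/
inductive Exec : Prog → State → ℕ → State → Prop
  | skip (σ : State) : Exec .skip σ 1 σ
  | write (σ : State) (a : ℕ) (i e : Expr) :
      Exec (.write a i e) σ
        (i.cost σ + e.cost σ + (1 + (i.val σ).size + (e.val σ).size))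
        (σ.set a (i.val σ) (e.val σ))
  | seq {p q : Prog} {σ τ ρ : State} {T U : ℕ} :
      Exec p σ T τ → Exec q τ U ρ → Exec (.seq p q) σ (T + U) ρ
  | ite_pos {e : Expr} {p q : Prog} {σ τ : State} {T : ℕ} :
      e.val σ ≠ 0 → Exec p σ T τ →
      Exec (.ite e p q) σ (e.cost σ + (1 + (e.val σ).size) + T) τ
  | ite_zero {e : Expr} {p q : Prog} {σ τ : State} {T : ℕ} :
      e.val σ = 0 → Exec q σ T τ →
      Exec (.ite e p q) σ (e.cost σ + (1 + (e.val σ).size) + T) τ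
  | loop_pos {e : Expr} {p : Prog} {σ τ ρ : State} {T U : ℕ} :
      e.val σ ≠ 0 → Exec p σ T τ → Exec (.loop e p) τ U ρ →
      Exec (.loop e p) σ (e.cost σ + (1 + (e.val σ).size) + T + U) ρ
  | loop_zero {e : Expr} {p : Prog} {σ : State} :
      e.val σ = 0 → Exec (.loop e p) σ (e.cost σ + (1 + (e.val σ).size)) σ

/-- The machine is deterministic: running time and final state are determined by the program and
the initial state. -/
theorem Exec.deterministic {p : Prog} {σ τ τ' : State} {T T' : ℕ}
    (h : Exec p σ T τ) (h' : Exec p σ T' τ') : T = T' ∧ τ = τ' := by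
  induction h generalizing T' τ' with
  | skip σ => cases h'; exact ⟨rfl, rfl⟩
  | write σ a i e => cases h'; exact ⟨rfl, rfl⟩
  | seq _ _ ih1 ih2 =>
    cases h' with
    | seq h1 h2 =>
      obtain ⟨rfl, rfl⟩ := ih1 h1
      obtain ⟨rfl, rfl⟩ := ih2 h2
      exact ⟨rfl, rfl⟩
  | ite_pos he _ ih =>
    cases h' with
    | ite_pos _ h1 => obtain ⟨rfl, rfl⟩ := ih h1; exact ⟨rfl, rfl⟩
    | ite_zero h0 _ => exact absurd h0 he
  | ite_zero he _ ih =>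
    cases h' with
    | ite_pos h0 _ => exact absurd he h0
    | ite_zero _ h1 => obtain ⟨rfl, rfl⟩ := ih h1; exact ⟨rfl, rfl⟩
  | loop_pos he _ _ ih1 ih2 =>
    cases h' with
    | loop_pos _ h1 h2 =>
      obtain ⟨rfl, rfl⟩ := ih1 h1
      obtain ⟨rfl, rfl⟩ := ih2 h2
      exact ⟨rfl, rfl⟩
    | loop_zero h0 => exact absurd h0 he
  | loop_zero he =>
    cases h' with
    | loop_pos h0 _ _ => exact absurd he h0
    | loop_zero _ => exact ⟨rfl, rfl⟩

end RAM

/-! ### The counting problem -/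

namespace DomSet

/-- The set of vertices dominated by `S`: those that lie in `S` or have a neighbour in `S`. -/
def dominated {V : Type*} (G : SimpleGraph V) (S : Finset V) : Set V :=
  {v | v ∈ S ∨ ∃ u ∈ S, G.Adj u v}

/-- The number of vertex sets of size `k` that dominate at least `t` vertices. -/
noncomputable def count {n : ℕ} (G : SimpleGraph (Fin n)) (k t : ℕ) : ℕ :=
  {S : Finset (Fin n) | S.card = k ∧ t ≤ (dominated G S).ncard}.ncard

open Classical in
/-- The initial memory: array `0` starts with the numbers `n`, `k`, `t`, array `1` holds the
adjacency matrix of the graph row by row, and all other cells are `0`. -/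
noncomputable def input {n : ℕ} (G : SimpleGraph (Fin n)) (k t : ℕ) : RAM.State := fun a i =>
  if a = 0 then (if i = 0 then n else if i = 1 then k else if i = 2 then t else 0)
  else if a = 1 then
    (if ∃ u v : Fin n, i = (u : ℕ) * n + (v : ℕ) ∧ G.Adj u v then 1 else 0)
  else 0

/-- The number of bits of the input: `n ^ 2` for the adjacency matrix, and the numbers `n`, `k`,
`t` in binary. -/
def inputLength (n k t : ℕ) : ℕ := n ^ 2 + n.size + k.size + t.size

/-- The sum of the binomial coefficients `n.choose i` over `0 ≤ i ≤ r`. -/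
def binomDown (n r : ℕ) : ℕ := ∑ i ∈ Finset.range (r + 1), n.choose i

end DomSet

/-! If k ≤ ⌊t/2⌋, all sets of at most k vertices can be inspected one by one. If k ≥ t, every k-set
qualifies, because a set dominates itself. Otherwise one counts the k-sets S that dominate fewer
than t vertices, which means that the boundary N[S] \ S has at most r = t-1-k elements; here r ≤
⌊t/2⌋. The boundary D lies in the complement W of S, and there are signed binomial weights w(|R|),
zero for |R| > r, whose sum over D ⊆ R ⊆ W is 1 if |D| ≤ r and 0 otherwise (`sum_weight_Icc`).
Exchanging summations (`count_add_sum`) leaves a sum over the sets R of at most r vertices of w(|R|)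
times the number of k-sets that avoid R and have their boundary inside R. These are the k-sets that
are unions of components of G - R, so their number is the coefficient of x^k in the product of 1 +
x^|C| over the components C. With x = 2^(n+1) it is a digit of a single number (`avoiding_eq`).

Sets are encoded by binary numbers. The next code with at most l ones is found directly
(`isNext_ite`), so the main loop makes one pass per set of at most l elements, and one pass takes
polynomial time. A weakest-precondition calculus for programs whose loops make n passes
(`Block.wp.halts`) gives the correctness of a pass and its time bound together. -/

namespace RAM

/-! ### Polynomial bounds for bit lengths and evaluation costs -/

open Polynomial in
/-- A bound for the bit length of the value of an expression, as a polynomial in a bound for the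
bit lengths of all memory cells. -/
noncomputable def Expr.sizeBound : Expr → Polynomial ℕ
  | .const c => C c.size
  | .read _ _ => X
  | .add x y => x.sizeBound + y.sizeBound + 1
  | .sub x _ => x.sizeBound
  | .mul x y => x.sizeBound + y.sizeBound
  | .div x _ => x.sizeBound
  | .mod x _ => x.sizeBound

open Polynomial in
/-- A bound for the time needed to evaluate an expression, as a polynomial in a bound for the
bit lengths of all memory cells. -/
noncomputable def Expr.costBound : Expr → Polynomial ℕ
  | .const c => 1 + C c.size
  | .read _ i => i.costBound + (1 + i.sizeBound + X)
  | .add x y => x.costBound + y.costBound + (1 + x.sizeBound + y.sizeBound)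
  | .sub x y => x.costBound + y.costBound + (1 + x.sizeBound + y.sizeBound)
  | .mul x y => x.costBound + y.costBound + (1 + x.sizeBound) * (1 + y.sizeBound)
  | .div x y => x.costBound + y.costBound + (1 + x.sizeBound) * (1 + y.sizeBound)
  | .mod x y => x.costBound + y.costBound + (1 + x.sizeBound) * (1 + y.sizeBound)

/-- All memory cells hold numbers of at most `B` bits. -/
def State.Bounded (B : ℕ) (σ : State) : Prop := ∀ a i, σ a i < 2 ^ B

theorem Expr.size_val_le {B : ℕ} {σ : State} (h : σ.Bounded B) (e : Expr) :
    (e.val σ).size ≤ e.sizeBound.eval B := by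
  induction e with
  | const c => simp [val, sizeBound]
  | read a i => simpa [val, sizeBound] using Nat.size_le.2 (h a _)
  | add x y hx hy =>
    simp only [val, sizeBound, Polynomial.eval_add, Polynomial.eval_one]
    rw [Nat.size_le] at *
    have h1 : 2 ^ x.sizeBound.eval B ≤ 2 ^ (x.sizeBound.eval B + y.sizeBound.eval B) :=
      Nat.pow_le_pow_right (by norm_num) (by omega)
    have h2 : 2 ^ y.sizeBound.eval B ≤ 2 ^ (x.sizeBound.eval B + y.sizeBound.eval B) :=
      Nat.pow_le_pow_right (by norm_num) (by omega)
    rw [pow_succ]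
    omega
  | sub x y hx hy => exact (Nat.size_le_size (Nat.sub_le _ _)).trans hx
  | mul x y hx hy =>
    simp only [val, sizeBound, Polynomial.eval_add]
    rw [Nat.size_le] at *
    rw [pow_add]
    exact Nat.mul_lt_mul'' hx hy
  | div x y hx hy => exact (Nat.size_le_size (Nat.div_le_self _ _)).trans hx
  | mod x y hx hy => exact (Nat.size_le_size (Nat.mod_le _ _)).trans hx

theorem Expr.cost_le {B : ℕ} {σ : State} (h : σ.Bounded B) (e : Expr) :
    e.cost σ ≤ e.costBound.eval B := by
  induction e with
  | const c => simp [cost, costBound]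
  | read a i hi =>
    have := size_val_le h i
    have := Nat.size_le.2 (h a (i.val σ))
    simp only [cost, costBound, Polynomial.eval_add, Polynomial.eval_one, Polynomial.eval_X]
    gcongr
  | add x y hx hy | sub x y hx hy | mul x y hx hy | div x y hx hy | mod x y hx hy =>
    have := size_val_le h x
    have := size_val_le h y
    simp only [cost, costBound, Polynomial.eval_add, Polynomial.eval_one, Polynomial.eval_mul]
    gcongr

theorem State.set_apply (σ : State) (a i v b j : ℕ) :
    σ.set a i v b j = if b = a ∧ j = i then v else σ b j := rfl

theorem State.set_of_ne (σ : State) {a b : ℕ} (i v : ℕ) (h : b ≠ a) : σ.set a i v b = σ b := by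
  funext j
  simp [State.set, h]

theorem State.Bounded.set {B : ℕ} {σ : State} (h : σ.Bounded B) (a i : ℕ) {v : ℕ}
    (hv : v < 2 ^ B) : (σ.set a i v).Bounded B := by
  intro b j
  rw [State.set_apply]
  split_ifs
  exacts [hv, h b j]

/-! ### Programs with bounded loops and their weakest preconditions -/

/-- Programs whose only loops run through the numbers below the content of cell `0` of array `0`. -/
inductive Block : Type
  | skip
  | write (a : ℕ) (i e : Expr)
  | seq (p q : Block)
  | ite (e : Expr) (p q : Block)
  | each (c : ℕ) (p : Block)

namespace Block

/-- Test for the end of the loop with counter `c`. -/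
def test (c : ℕ) : Expr := .sub (.read 0 (.const 0)) (.read c (.const 0))

/-- Increment of the counter `c`. -/
def next (c : ℕ) : Expr := .add (.read c (.const 0)) (.const 1)

/-- The underlying program. -/
def compile : Block → Prog
  | skip => .skip
  | write a i e => .write a i e
  | seq p q => .seq p.compile q.compile
  | ite e p q => .ite e p.compile q.compile
  | each c p => .seq (.write c (.const 0) (.const 0))
      (.loop (test c) (.seq p.compile (.write c (.const 0) (next c))))

/-- The arrays that are written. -/
def writes : Block → List ℕ
  | skip => []
  | write a _ _ => [a]
  | seq p q => p.writes ++ q.writes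
  | ite _ p q => p.writes ++ q.writes
  | each c p => c :: p.writes

/-- Array `0` is not written, and loop bodies do not write to the loop counters. -/
def ok : Block → Bool
  | skip => true
  | write a _ _ => a != 0
  | seq p q => p.ok && q.ok
  | ite _ p q => p.ok && q.ok
  | each c p => c != 0 && !(p.writes.contains c) && p.ok

open Polynomial in
/-- A bound for the running time of a writing instruction. -/
noncomputable def writeBound (i e : Expr) : Polynomial ℕ :=
  i.costBound + e.costBound + (1 + i.sizeBound + X)

open Polynomial in
/-- A bound for the running time, as a polynomial in a bound for the bit lengths of all memory
cells. -/
noncomputable def timeBound : Block → Polynomial ℕ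
  | skip => 1
  | write _ i e => writeBound i e
  | seq p q => p.timeBound + q.timeBound
  | ite e p q => e.costBound + (1 + e.sizeBound) + (p.timeBound + q.timeBound)
  | each c p => writeBound (.const 0) (.const 0) +
      ((X + 1) * ((test c).costBound + (1 + (test c).sizeBound)) +
        X * (p.timeBound + writeBound (.const 0) (next c)))

/-- Two states agree outside the arrays of a list. -/
def Agree (l : List ℕ) (τ σ : State) : Prop := ∀ a, a ∉ l → τ a = σ a

/-- The weakest precondition for `Q`, if no cell may receive a number of more than `B` bits. -/
def wp (B : ℕ) : Block → (State → Prop) → State → Prop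
  | skip, Q, σ => Q σ
  | write a i e, Q, σ => e.val σ < 2 ^ B ∧ Q (σ.set a (i.val σ) (e.val σ))
  | seq p q, Q, σ => p.wp B (q.wp B Q) σ
  | ite e p q, Q, σ => (e.val σ ≠ 0 → p.wp B Q σ) ∧ (e.val σ = 0 → q.wp B Q σ)
  | each c p, Q, σ => ∃ I : ℕ → State → Prop, I 0 σ ∧
      (∀ j < σ 0 0, ∀ τ, Agree (c :: p.writes) τ σ → I j τ →
        p.wp B (I (j + 1)) (τ.set c 0 j)) ∧
      ∀ τ, Agree (c :: p.writes) τ σ → I (σ 0 0) τ → Q (τ.set c 0 (σ 0 0))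

/-- The new postcondition may use that arrays which are not written are unchanged. Specifications
therefore only mention what a program computes, and framing is recovered here. -/
theorem wp_conseq {B : ℕ} {p : Block} {Q Q' : State → Prop} {σ : State} (h : p.wp B Q σ)
    (hQ : ∀ τ, Agree p.writes τ σ → Q τ → Q' τ) : p.wp B Q' σ := by
  induction p generalizing Q Q' σ with
  | skip => exact hQ σ (fun _ _ => rfl) h
  | write a i e =>
    refine ⟨h.1, hQ _ (fun b hb => ?_) h.2⟩
    exact State.set_of_ne _ _ _ (by simpa [writes] using hb)
  | seq p q hp hq =>
    refine hp (Q := q.wp B Q) h fun τ hτ hq1 => hq hq1 fun ρ hρ => hQ ρ fun a ha => ?_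
    simp only [writes, List.mem_append, not_or] at ha
    rw [hρ a ha.2, hτ a ha.1]
  | ite e p q hp hq =>
    refine ⟨fun he => hp (h.1 he) fun τ hτ => hQ τ fun a ha => hτ a ?_,
      fun he => hq (h.2 he) fun τ hτ => hQ τ fun a ha => hτ a ?_⟩
    all_goals
      simp only [writes, List.mem_append, not_or] at ha
      first | exact ha.1 | exact ha.2
  | each c p hp =>
    obtain ⟨I, h0, h1, h2⟩ := h
    refine ⟨I, h0, h1, fun τ hτ hI => hQ _ (fun a ha => ?_) (h2 τ hτ hI)⟩
    rw [State.set_of_ne _ _ _ (fun h => ha (by simp [writes, h])), hτ a ha]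

theorem wp_seq {B : ℕ} {p q : Block} {Q R : State → Prop} {σ : State} (h : p.wp B R σ)
    (hq : ∀ τ, Agree p.writes τ σ → R τ → q.wp B Q τ) : (seq p q).wp B Q σ :=
  wp_conseq (Q' := q.wp B Q) h hq

/-- The invariant `I j` speaks of the state before the counter receives the value `j`, so it need
not be shown stable under the increment. -/
theorem wp_each {B n c : ℕ} {p : Block} {Q : State → Prop} {σ : State} (hn : σ 0 0 = n)
    (I : ℕ → State → Prop) (h0 : I 0 σ)
    (hstep : ∀ j < n, ∀ τ, Agree (c :: p.writes) τ σ → I j τ → p.wp B (I (j + 1)) (τ.set c 0 j))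
    (hQ : ∀ τ, Agree (c :: p.writes) τ σ → I n τ → Q (τ.set c 0 n)) : (each c p).wp B Q σ := by
  subst hn
  exact ⟨I, h0, hstep, hQ⟩

/-! ### Termination within a time bound -/

/-- Terminating execution within time `T`, with all numbers bounded by `B` bits. -/
def _root_.RAM.Prog.Halts (B : ℕ) (p : Prog) (T : ℕ) (Q : State → Prop) (σ : State) : Prop :=
  ∃ t τ, Exec p σ t τ ∧ t ≤ T ∧ τ.Bounded B ∧ Q τ

theorem _root_.RAM.Prog.halts_write {B : ℕ} {σ : State} (hσ : σ.Bounded B) {a : ℕ} {i e : Expr}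
    {Q : State → Prop} (he : e.val σ < 2 ^ B) (hQ : Q (σ.set a (i.val σ) (e.val σ))) :
    (Prog.write a i e).Halts B ((writeBound i e).eval B) Q σ := by
  refine ⟨_, _, .write σ a i e, ?_, hσ.set _ _ he, hQ⟩
  have h1 := Expr.cost_le hσ i
  have h2 := Expr.cost_le hσ e
  have h3 := Expr.size_val_le hσ i
  have h4 := Nat.size_le.2 he
  simp only [writeBound, Polynomial.eval_add, Polynomial.eval_one, Polynomial.eval_X]
  gcongr

theorem _root_.RAM.Prog.Halts.seq {B : ℕ} {σ : State} {p q : Prog} {T U : ℕ} {Q R : State → Prop}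
    (hp : p.Halts B T R σ) (hq : ∀ τ, τ.Bounded B → R τ → q.Halts B U Q τ) :
    (Prog.seq p q).Halts B (T + U) Q σ := by
  obtain ⟨t, τ, h1, h2, h3, h4⟩ := hp
  obtain ⟨u, ρ, h5, h6, h7, h8⟩ := hq τ h3 h4
  exact ⟨_, ρ, .seq h1 h5, by omega, h7, h8⟩

theorem _root_.RAM.Prog.halts_ite {B : ℕ} {σ : State} (hσ : σ.Bounded B) {e : Expr} {p q : Prog}
    {T : ℕ} {Q : State → Prop} (hp : e.val σ ≠ 0 → p.Halts B T Q σ)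
    (hq : e.val σ = 0 → q.Halts B T Q σ) :
    (Prog.ite e p q).Halts B ((e.costBound + (1 + e.sizeBound)).eval B + T) Q σ := by
  have h1 := Expr.cost_le hσ e
  have h3 := Expr.size_val_le hσ e
  simp only [Polynomial.eval_add, Polynomial.eval_one]
  by_cases he : e.val σ = 0
  · obtain ⟨t, τ, h4, h5, h6, h7⟩ := hq he
    exact ⟨_, τ, .ite_zero he h4, by omega, h6, h7⟩
  · obtain ⟨t, τ, h4, h5, h6, h7⟩ := hp he
    exact ⟨_, τ, .ite_pos he h4, by omega, h6, h7⟩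

theorem _root_.RAM.Prog.Halts.mono {B : ℕ} {σ : State} {p : Prog} {T U : ℕ} {Q : State → Prop}
    (h : p.Halts B T Q σ) (hTU : T ≤ U) : p.Halts B U Q σ := by
  obtain ⟨t, τ, h1, h2, h3, h4⟩ := h
  exact ⟨t, τ, h1, h2.trans hTU, h3, h4⟩

/-- A loop whose body decreases a measure. -/
theorem _root_.RAM.Prog.halts_loop {B : ℕ} {e : Expr} {p : Prog} {T : ℕ} {I : State → Prop}
    (μ : State → ℕ)
    (hp : ∀ σ, σ.Bounded B → I σ → e.val σ ≠ 0 → p.Halts B T (fun τ => I τ ∧ μ τ < μ σ) σ)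
    {σ : State} (hσ : σ.Bounded B) (hI : I σ) :
    (Prog.loop e p).Halts B
      ((μ σ + 1) * (e.costBound + (1 + e.sizeBound)).eval B + μ σ * T)
      (fun τ => I τ ∧ e.val τ = 0) σ := by
  induction hm : μ σ using Nat.strong_induction_on generalizing σ with
  | _ m ih =>
    have h1 := Expr.cost_le hσ e
    have h3 := Expr.size_val_le hσ e
    simp only [Polynomial.eval_add, Polynomial.eval_one] at ih ⊢
    by_cases he : e.val σ = 0
    · refine ⟨_, σ, .loop_zero he, ?_, hσ, hI, he⟩
      rw [add_mul, one_mul]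
      have := Nat.zero_le (m * T)
      have := Nat.zero_le (m * (e.costBound.eval B + (1 + e.sizeBound.eval B)))
      omega
    · obtain ⟨t, τ, h4, h5, h6, h7, h8⟩ := hp σ hσ hI he
      obtain ⟨u, ρ, h9, h10, h11, h12⟩ := ih (μ τ) (by omega) h6 h7 rfl
      refine ⟨_, ρ, .loop_pos he h4 h9, ?_, h11, h12⟩
      -- The measure may drop by more than one; `c` is the surplus.
      obtain ⟨c, rfl⟩ : ∃ c, m = μ τ + 1 + c := ⟨m - (μ τ + 1), by omega⟩
      generalize e.costBound.eval B = x at *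
      generalize e.sizeBound.eval B = y at *
      nlinarith [Nat.zero_le (c * T), Nat.zero_le (c * (x + (1 + y)))]

theorem agree_of_exec {p : Block} {σ τ : State} {T : ℕ} (h : Exec p.compile σ T τ) :
    Agree p.writes τ σ := by
  induction p generalizing σ τ T with
  | skip => cases h; exact fun _ _ => rfl
  | write a i e =>
    cases h
    exact fun b hb => State.set_of_ne _ _ _ (by simpa [writes] using hb)
  | seq p q hp hq =>
    cases h with
    | seq h1 h2 =>
      intro a ha
      simp only [writes, List.mem_append, not_or] at ha
      rw [hq h2 a ha.2, hp h1 a ha.1]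
  | ite e p q hp hq =>
    intro a ha
    simp only [writes, List.mem_append, not_or] at ha
    cases h with
    | ite_pos _ h => exact hp h a ha.1
    | ite_zero _ h => exact hq h a ha.2
  | each c p hp =>
    -- Induction on the execution needs the program as a variable, tied to the loop by an equation.
    have key : ∀ {q : Prog} {σ T τ}, Exec q σ T τ →
        q = .loop (test c) (.seq p.compile (.write c (.const 0) (next c))) →
        Agree (c :: p.writes) τ σ := by
      intro q σ T τ h
      induction h with
      | loop_pos he h1 h2 ih1 ih2 =>
        intro hq
        have := ih2 hq
        injection hq with _ hq
        subst hq
        cases h1 with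
        | seq h3 h4 =>
          cases h4
          intro a ha
          have ha' : a ≠ c ∧ a ∉ p.writes := by simpa using ha
          rw [this a ha, State.set_of_ne _ _ _ ha'.1, hp h3 a ha'.2]
      | loop_zero he => exact fun _ _ _ => rfl
      | _ => intro h; cases h
    cases h with
    | seq h1 h2 =>
      cases h1
      intro a ha
      rw [key h2 rfl a ha]
      exact State.set_of_ne _ _ _ fun h => ha (by simp [writes, h])

theorem zero_notMem_writes {p : Block} (hp : p.ok) : 0 ∉ p.writes := by
  induction p with
  | skip => simp [writes]
  | write a i e =>
    simp only [ok, bne_iff_ne] at hp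
    simpa [writes] using Ne.symm hp
  | seq p q ihp ihq | ite e p q ihp ihq =>
    simp only [ok, Bool.and_eq_true] at hp
    exact fun h => (List.mem_append.1 h).elim (ihp hp.1) (ihq hp.2)
  | each c p ih =>
    simp only [ok, Bool.and_eq_true, bne_iff_ne] at hp
    simp [writes, ih hp.2, Ne.symm hp.1.1]

/-- Soundness of the weakest precondition, with the bound for the running time. -/
theorem wp.halts {B : ℕ} {p : Block} {Q : State → Prop} {σ : State} (h : p.wp B Q σ)
    (hp : p.ok) (hσ : σ.Bounded B) (hB : σ 0 0 ≤ B) :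
    p.compile.Halts B (p.timeBound.eval B) Q σ := by
  induction p generalizing Q σ with
  | skip => exact ⟨1, σ, .skip σ, by simp [timeBound], hσ, h⟩
  | write a i e => exact Prog.halts_write hσ h.1 h.2
  | seq p q ihp ihq =>
    simp only [ok, Bool.and_eq_true] at hp
    obtain ⟨t, τ, h1, h2, h3, h4⟩ := ihp (Q := q.wp B Q) h hp.1 hσ hB
    have h5 := agree_of_exec h1 0 (zero_notMem_writes hp.1)
    obtain ⟨u, ρ, h6, h7, h8, h9⟩ := ihq h4 hp.2 h3 (by rwa [h5])
    refine ⟨_, ρ, .seq h1 h6, ?_, h8, h9⟩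
    simp only [timeBound, Polynomial.eval_add]
    omega
  | ite e p q ihp ihq =>
    simp only [ok, Bool.and_eq_true] at hp
    rw [timeBound, Polynomial.eval_add, Polynomial.eval_add (p := p.timeBound)]
    exact Prog.halts_ite hσ (fun he => (ihp (h.1 he) hp.1 hσ hB).mono (by omega))
      fun he => (ihq (h.2 he) hp.2 hσ hB).mono (by omega)
  | each c p ih =>
    obtain ⟨I, h0, h1, h2⟩ := h
    have h00 := zero_notMem_writes hp
    simp only [ok, Bool.and_eq_true, bne_iff_ne, ne_eq, Bool.not_eq_true',
      List.contains_eq_mem, decide_eq_false_iff_not] at hp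
    obtain ⟨⟨hc0, hcp⟩, hpok⟩ := hp
    -- The counter never exceeds `n ≤ B`, so it fits into `B` bits; the same inequality lets `X`
    -- stand for the number of passes in `timeBound`.
    have hB' : B < 2 ^ B := Nat.lt_two_pow_self
    set n := σ 0 0 with hn
    have hloop := Prog.halts_loop (B := B) (e := test c)
      (p := .seq p.compile (.write c (.const 0) (next c)))
      (T := p.timeBound.eval B + (writeBound (.const 0) (next c)).eval B)
      (I := fun ρ => ∃ j τ, j ≤ n ∧ Agree (c :: p.writes) τ σ ∧ I j τ ∧ ρ = τ.set c 0 j)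
      (fun ρ => n - ρ c 0) ?_ (σ := σ.set c 0 0) (hσ.set _ _ (by positivity))
      ⟨0, σ, Nat.zero_le _, fun _ _ => rfl, h0, rfl⟩
    · have hw := Prog.halts_write (a := c) (i := .const 0) (e := .const 0)
        (Q := fun τ => τ = σ.set c 0 0) hσ (by simp only [Expr.val]; positivity) rfl
      refine Prog.Halts.mono (Prog.Halts.seq hw (Q := Q)
        (U := (n + 1) * ((test c).costBound + (1 + (test c).sizeBound)).eval B +
          n * (p.timeBound.eval B + (writeBound (.const 0) (next c)).eval B)) ?_) ?_
      · rintro _ - rfl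
        obtain ⟨t, τ, h3, h4, h5, ⟨j, ρ, hj, hρ, hI, rfl⟩, h6⟩ := hloop
        refine ⟨t, _, h3, by simpa [State.set_apply] using h4, h5, ?_⟩
        have : j = n := by
          have : ρ 0 0 = n := by rw [hρ 0 h00]
          simp [test, Expr.val, State.set_apply, Ne.symm hc0, this] at h6
          omega
        subst this
        exact h2 ρ hρ hI
      · simp only [timeBound, Polynomial.eval_add, Polynomial.eval_one, Polynomial.eval_X,
          Polynomial.eval_mul]
        gcongr
    · rintro ρ hρB ⟨j, τ, hj, hτ, hI, rfl⟩ he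
      have hτ0 : τ 0 0 = n := by rw [hτ 0 h00]
      have hj' : j < n := by
        simp [test, Expr.val, State.set_apply, Ne.symm hc0, hτ0] at he
        omega
      have h3 := h1 j hj' τ hτ hI
      obtain ⟨t, ρ, h4, h5, h6, h7⟩ := ih h3 hpok hρB
        (by rw [State.set_of_ne _ _ _ (Ne.symm hc0), hτ0]; exact hB)
      have h8 := agree_of_exec h4
      have h9 : ρ c 0 = j := by rw [h8 c hcp]; simp [State.set_apply]
      refine Prog.Halts.seq ⟨t, ρ, h4, h5, h6, (rfl : ρ = ρ)⟩ ?_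
      rintro _ - rfl
      refine Prog.halts_write h6 ?_ ⟨⟨j + 1, ρ, hj', fun a ha => ?_, h7, ?_⟩, ?_⟩
      · simp only [next, Expr.val, h9]
        omega
      · have ha' : a ≠ c ∧ a ∉ p.writes := by simpa using ha
        rw [h8 a ha'.2, State.set_of_ne _ _ _ ha'.1, hτ a ha]
      · simp [next, Expr.val, h9]
      · simp only [next, Expr.val, h9, State.set_apply, and_self, if_true]
        omega

end Block
end RAM

/-! ### Weights that detect boundaries of at most r elements -/

namespace DomSet

open Finset RAM

/-- Pascal's rule for `a.choose i` splits the sum into the same sum for smaller `a` and `r` and a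
sum with `(a - i).choose (r + 1 - i)`. The latter is `a.choose (r + 1)` times the alternating sum of
a row of Pascal's triangle, hence 0. -/
theorem alternating_sum_choose_mul_choose {a r : ℕ} (h : r < a) :
    ∑ i ∈ range (r + 1), (-1 : ℤ) ^ (r - i) * ((a - i - 1).choose (r - i) * a.choose i) = 1 := by
  induction r generalizing a with
  | zero => simp
  | succ r ih =>
    obtain ⟨a, rfl⟩ : ∃ b, a = b + 1 := ⟨a - 1, by omega⟩
    have h1 : ∑ i ∈ range (r + 1 + 1),
        (-1 : ℤ) ^ (r + 1 - i) * ((a - i).choose (r + 1 - i) * a.choose i) = 0 := by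
      have h2 := Int.alternating_sum_range_choose_of_ne (n := r + 1) (by omega)
      rw [← Finset.sum_range_reflect] at h2
      have h3 : ∀ i ∈ range (r + 1 + 1),
          (-1 : ℤ) ^ (r + 1 - i) * ((a - i).choose (r + 1 - i) * a.choose i) =
          a.choose (r + 1) *
            ((-1) ^ (r + 1 + 1 - 1 - i) * ((r + 1).choose (r + 1 + 1 - 1 - i) : ℕ)) := by
        intro i hi
        have hi' : i ≤ r + 1 := by simpa [Nat.lt_succ_iff] using hi
        have h4 := Nat.choose_mul (n := a) (k := r + 1) (s := i) hi'
        have h5 : r + 1 + 1 - 1 - i = r + 1 - i := by omega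
        rw [h5, Nat.choose_symm hi']
        have h6 : (a.choose (r + 1) * (r + 1).choose i : ℤ) =
          a.choose i * (a - i).choose (r + 1 - i) := by exact_mod_cast h4
        linear_combination (-(-1) ^ (r + 1 - i) : ℤ) * h6
      rw [sum_congr rfl h3, ← mul_sum, h2, mul_zero]
    rw [sum_range_succ'] at h1 ⊢
    have h7 : ∀ i ∈ range (r + 1),
        (-1 : ℤ) ^ (r + 1 - (i + 1)) *
          ((a + 1 - (i + 1) - 1).choose (r + 1 - (i + 1)) * (a + 1).choose (i + 1)) =
        (-1 : ℤ) ^ (r - i) * ((a - i - 1).choose (r - i) * a.choose i) +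
        (-1 : ℤ) ^ (r + 1 - (i + 1)) *
          ((a - (i + 1)).choose (r + 1 - (i + 1)) * a.choose (i + 1)) := by
      intro i _
      have e1 : a + 1 - (i + 1) - 1 = a - i - 1 := by omega
      have e2 : r + 1 - (i + 1) = r - i := by omega
      have e3 : a - (i + 1) = a - i - 1 := by omega
      rw [e1, e2, e3, Nat.choose_succ_succ]
      push_cast
      ring
    rw [sum_congr rfl h7, sum_add_distrib, ih (by omega)]
    simp only [Nat.sub_zero, Nat.choose_zero_right, Nat.add_sub_cancel] at h1 ⊢
    linarith

/-- The coefficients that express the number of sets with a boundary of at most `r` elements. -/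
def weight (m r j : ℕ) : ℤ := if j ≤ r then (-1) ^ (r - j) * (m - j - 1).choose (r - j) else 0

/-- Write R = D ∪ T with T ⊆ W \ D. Only |T| matters, so for |D| ≤ r this is the alternating
identity with |W \ D| and r - |D|; for |D| > r all weights vanish. -/
theorem sum_weight_Icc {α : Type*} [DecidableEq α] {D W : Finset α} (hDW : D ⊆ W) {r : ℕ}
    (hr : r < W.card) :
    ∑ R ∈ W.powerset with D ⊆ R, weight W.card r R.card = if D.card ≤ r then 1 else 0 := by
  have h1 : ∑ R ∈ W.powerset with D ⊆ R, weight W.card r R.card =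
      ∑ T ∈ (W \ D).powerset, weight W.card r (D.card + T.card) := by
    refine sum_nbij' (fun R => R \ D) (fun T => D ∪ T) ?_ ?_ ?_ ?_ ?_
    · intro R hR
      simp only [mem_filter, mem_powerset] at hR ⊢
      exact sdiff_subset_sdiff hR.1 subset_rfl
    · intro T hT
      simp only [mem_filter, mem_powerset] at hT ⊢
      exact ⟨union_subset hDW (hT.trans sdiff_subset), subset_union_left⟩
    · intro R hR
      simp only [mem_filter, mem_powerset] at hR
      exact union_sdiff_of_subset hR.2
    · intro T hT
      simp only [mem_powerset, subset_sdiff] at hT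
      exact union_sdiff_cancel_left hT.2.symm
    · intro R hR
      simp only [mem_filter, mem_powerset] at hR
      rw [add_comm, card_sdiff_add_card_eq_card hR.2]
  have hcard : (W \ D).card + D.card = W.card := card_sdiff_add_card_eq_card hDW
  rw [h1, sum_powerset_apply_card (fun i => weight W.card r (D.card + i))]
  generalize (W \ D).card = a at *
  generalize W.card = m at *
  generalize D.card = s at *
  split_ifs with hs
  · obtain ⟨d, rfl⟩ := Nat.exists_eq_add_of_le hs
    rw [← alternating_sum_choose_mul_choose (a := a) (r := d) (by omega)]
    -- The weights vanish for |T| > d, which cuts the range down to that of the identity.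
    refine (sum_subset (range_subset_range.2 (by omega)) ?_).symm.trans (sum_congr rfl ?_)
    · intro i _ hi
      have : ¬ s + i ≤ s + d := by
        simp only [mem_range] at hi
        omega
      simp [weight, this]
    · intro i hi
      have hi' : i ≤ d := by simpa [Nat.lt_succ_iff] using hi
      have e1 : s + d - (s + i) = d - i := by omega
      have e2 : m - (s + i) - 1 = a - i - 1 := by omega
      simp only [weight, add_le_add_iff_left, hi', if_true, e1, e2, nsmul_eq_mul]
      ring
  · refine sum_eq_zero fun i _ => ?_
    have : ¬ s + i ≤ r := by omega
    simp [weight, this]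

/-! ### Reduction to sets that avoid R and have their boundary in R -/

open Classical in
/-- The dominated vertices, as a finite set. -/
noncomputable def nbhd {n : ℕ} (G : SimpleGraph (Fin n)) (S : Finset (Fin n)) : Finset (Fin n) :=
  {v | v ∈ S ∨ ∃ u ∈ S, G.Adj u v}

theorem subset_nbhd {n : ℕ} (G : SimpleGraph (Fin n)) (S : Finset (Fin n)) : S ⊆ nbhd G S :=
  fun v hv => by simp [nbhd, hv]

theorem count_eq {n : ℕ} (G : SimpleGraph (Fin n)) (k t : ℕ) :
    count G k t = #{S : Finset (Fin n) | #S = k ∧ t ≤ #(nbhd G S)} := by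
  rw [count, ← Set.ncard_coe_finset]
  congr 1
  ext S
  have : dominated G S = nbhd G S := by ext v; simp [dominated, nbhd]
  simp [this, Set.ncard_coe_finset]

open Classical in
/-- The number of sets of `k` vertices that avoid `R` and have all their outer neighbours in `R`. -/
noncomputable def avoiding {n : ℕ} (G : SimpleGraph (Fin n)) (k : ℕ) (R : Finset (Fin n)) : ℕ :=
  #{S : Finset (Fin n) | #S = k ∧ Disjoint S R ∧ nbhd G S \ S ⊆ R}

/-- For a fixed k-set S, the sets R that count it lie between its boundary and its complement. Their
weights sum to 1 exactly if the boundary has at most t-1-k elements, that is, if S dominates fewer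
than t vertices. -/
theorem count_add_sum {n : ℕ} (G : SimpleGraph (Fin n)) {k t : ℕ} (hkt : k < t) (htn : t ≤ n) :
    (count G k t : ℤ) + ∑ R : Finset (Fin n), weight (n - k) (t - 1 - k) #R * avoiding G k R =
      n.choose k := by
  classical
  have h1 : ∑ R : Finset (Fin n), weight (n - k) (t - 1 - k) #R * avoiding G k R =
      #{S : Finset (Fin n) | #S = k ∧ ¬ t ≤ #(nbhd G S)} := by
    calc _ = ∑ S ∈ powersetCard k (univ : Finset (Fin n)),
          ∑ R ∈ Sᶜ.powerset with nbhd G S \ S ⊆ R, weight (n - k) (t - 1 - k) #R := by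
          simp only [avoiding, card_filter, Nat.cast_sum, mul_sum]
          rw [sum_comm, powersetCard_eq_filter, powerset_univ, sum_filter]
          refine sum_congr rfl fun S _ => ?_
          simp only [Nat.cast_ite, mul_ite, Nat.cast_one, mul_one, Nat.cast_zero, mul_zero]
          rw [← sum_filter]
          split_ifs with hS
          · refine sum_congr ?_ fun _ _ => rfl
            ext R
            rw [mem_filter, mem_filter, mem_powerset, subset_compl_iff_disjoint_left]
            simp [hS]
          · refine sum_eq_zero fun R hR => ?_
            exact absurd (mem_filter.1 hR).2.1 hS
      _ = ∑ S ∈ powersetCard k (univ : Finset (Fin n)),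
          if #(nbhd G S \ S) ≤ t - 1 - k then 1 else 0 := by
          refine sum_congr rfl fun S hS => ?_
          have hk : #S = k := (mem_powersetCard.1 hS).2
          have hc : #Sᶜ = n - k := by rw [card_compl, Fintype.card_fin, hk]
          rw [← hc]
          -- The required t-1-k < n-k comes from k < t ≤ n.
          refine sum_weight_Icc (fun v hv => ?_) (by omega)
          simp only [mem_sdiff] at hv
          simpa using hv.2
      _ = _ := by
          rw [← sum_filter, powersetCard_eq_filter, powerset_univ, filter_filter,
            card_eq_sum_ones, Nat.cast_sum]
          refine sum_congr ?_ fun _ _ => by simp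
          ext S
          have := card_sdiff_add_card_eq_card (subset_nbhd G S)
          simp only [mem_filter, mem_univ, true_and, and_congr_right_iff]
          omega
  rw [h1, count_eq, ← Nat.cast_add, ← filter_filter, ← filter_filter,
    card_filter_add_card_filter_not]
  norm_cast
  have h2 := card_powersetCard k (univ : Finset (Fin n))
  rwa [powersetCard_eq_filter, powerset_univ, card_univ, Fintype.card_fin] at h2

theorem count_of_le {n : ℕ} (G : SimpleGraph (Fin n)) {k t : ℕ} (h : t ≤ k) :
    count G k t = n.choose k := by
  have h2 := card_powersetCard k (univ : Finset (Fin n))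
  rw [card_univ, Fintype.card_fin] at h2
  rw [count_eq, ← h2, powersetCard_eq_filter, powerset_univ]
  congr 1
  ext S
  have := card_le_card (subset_nbhd G S)
  simp only [mem_filter, mem_univ, true_and, and_iff_left_iff_imp]
  omega

theorem count_eq_zero {n : ℕ} (G : SimpleGraph (Fin n)) {k t : ℕ} (h : n < k ∨ n < t) :
    count G k t = 0 := by
  rw [count_eq, card_eq_zero, filter_eq_empty_iff]
  rintro S - ⟨h1, h2⟩
  have h3 := card_le_univ S
  have h4 := card_le_univ (nbhd G S)
  rw [Fintype.card_fin] at h3 h4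
  omega

/-! ### Reading coefficients as digits -/

/-- A number whose digits in base `b` count the sets of a family by their size. -/
theorem sum_pow_card_div_mod {α : Type*} [DecidableEq α] (F : Finset (Finset α)) {b : ℕ}
    (hb : #F < b) (k : ℕ) :
    (∑ S ∈ F, b ^ #S) / b ^ k % b = #{S ∈ F | #S = k} := by
  have hb0 : 0 < b := by omega
  -- There is no carry into digit `k`: fewer than `b` sets contribute, each at most `b ^ (k - 1)`.
  have h1 : ∑ S ∈ F with #S < k, b ^ #S < b ^ k := by
    cases k with
    | zero => simp
    | succ k =>
      calc ∑ S ∈ F with #S < k + 1, b ^ #S ≤ #{S ∈ F | #S < k + 1} * b ^ k :=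
            sum_le_card_nsmul _ _ _ fun S hS =>
              Nat.pow_le_pow_right hb0 (Nat.lt_succ_iff.1 (mem_filter.1 hS).2)
        _ < b * b ^ k :=
            Nat.mul_lt_mul_of_pos_right ((card_filter_le _ _).trans_lt hb) (by positivity)
        _ = b ^ (k + 1) := by rw [pow_succ, mul_comm]
  have h2 : b ^ (k + 1) ∣ ∑ S ∈ F with k < #S, b ^ #S :=
    dvd_sum fun S hS => pow_dvd_pow _ (mem_filter.1 hS).2
  obtain ⟨c, hc⟩ := h2
  have h3 : ∑ S ∈ F, b ^ #S =
      ∑ S ∈ F with #S < k, b ^ #S + b ^ k * (#{S ∈ F | #S = k} + b * c) := by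
    rw [← sum_filter_add_sum_filter_not F (fun S => #S < k), mul_add, ← mul_assoc, ← pow_succ, ← hc,
      ← sum_filter_add_sum_filter_not {S ∈ F | ¬ #S < k} (fun S => #S = k), filter_filter,
      filter_filter]
    congr 2
    · rw [mul_comm, ← smul_eq_mul, ← sum_const]
      refine sum_congr ?_ ?_
      · ext S
        simp only [mem_filter, and_congr_right_iff]
        omega
      · intro S hS
        rw [(mem_filter.1 hS).2]
    · refine sum_congr ?_ fun _ _ => rfl
      ext S
      simp only [mem_filter, and_congr_right_iff]
      omega
  rw [h3, Nat.add_mul_div_left _ _ (by positivity), Nat.div_eq_of_lt h1, zero_add,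
    Nat.add_mul_mod_self_left, Nat.mod_eq_of_lt ((card_filter_le _ _).trans_lt hb)]

/-- The generating polynomial of the unions of the classes of a labelling. -/
theorem prod_one_add_pow_class {n : ℕ} (R : Finset (Fin n)) (lab : Fin n → ℕ) (b : ℕ) {N : ℕ}
    (hN : ∀ v, lab v < N) :
    ∏ l ∈ range N, (if #{v | v ∉ R ∧ lab v = l} = 0 then 1 else 1 + b ^ #{v | v ∉ R ∧ lab v = l}) =
      ∑ S : Finset (Fin n) with Disjoint S R ∧
        ∀ u v, u ∉ R → v ∉ R → lab u = lab v → (u ∈ S ↔ v ∈ S), b ^ #S := by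
  classical
  -- The labels that occur. An unused label must give the factor 1, not 1 + b^0 = 2.
  set L := Rᶜ.image lab with hL
  have h1 : ∏ l ∈ range N,
      (if #{v | v ∉ R ∧ lab v = l} = 0 then 1 else 1 + b ^ #{v | v ∉ R ∧ lab v = l}) =
      ∏ l ∈ L, (1 + b ^ #{v | v ∉ R ∧ lab v = l}) := by
    refine (prod_subset ?_ ?_).symm.trans (prod_congr rfl ?_)
    · intro l hl
      obtain ⟨v, _, rfl⟩ := mem_image.1 hl
      exact mem_range.2 (hN v)
    · intro l _ hl
      rw [if_pos]
      rw [card_eq_zero, filter_eq_empty_iff]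
      rintro v - ⟨hv, rfl⟩
      exact hl (mem_image_of_mem _ (mem_compl.2 hv))
    · intro l hl
      obtain ⟨v, hv, rfl⟩ := mem_image.1 hl
      rw [if_neg]
      exact card_ne_zero_of_mem (a := v) (by simpa using hv)
  rw [h1, prod_one_add]
  -- A set of occurring labels corresponds to the union of its classes.
  refine sum_nbij' (fun T => univ.filter fun v => v ∉ R ∧ lab v ∈ T) (fun S => S.image lab) ?_ ?_ ?_ ?_ ?_
  · intro T _
    simp only [mem_filter, mem_univ, true_and, disjoint_left]
    exact ⟨fun v hv => hv.1, fun u v hu hv h => by simp [hu, hv, h]⟩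
  · intro S hS
    simp only [mem_filter, mem_univ, true_and, disjoint_left] at hS
    rw [mem_powerset, hL]
    exact image_subset_image fun v hv => by simpa using hS.1 hv
  · intro T hT
    rw [mem_powerset] at hT
    ext l
    simp only [mem_image, mem_filter, mem_univ, true_and]
    refine ⟨?_, fun hl => ?_⟩
    · rintro ⟨v, hv, rfl⟩
      exact hv.2
    · obtain ⟨v, hv, rfl⟩ := mem_image.1 (hT hl)
      exact ⟨v, ⟨by simpa using hv, hl⟩, rfl⟩
  · intro S hS
    simp only [mem_filter, mem_univ, true_and, disjoint_left] at hS
    ext v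
    simp only [mem_image, mem_filter, mem_univ, true_and]
    refine ⟨?_, fun hv => ⟨hS.1 hv, v, hv, rfl⟩⟩
    rintro ⟨hv, u, hu, huv⟩
    exact (hS.2 u v (hS.1 hu) hv huv).1 hu
  · intro T _
    rw [prod_pow_eq_pow_sum]
    congr 1
    rw [card_eq_sum_card_fiberwise (f := lab) (t := T)]
    · refine sum_congr rfl fun l hl => ?_
      congr 1
      ext v
      simp only [mem_filter, mem_univ, true_and]
      constructor
      · rintro ⟨hv, rfl⟩
        exact ⟨⟨hv, hl⟩, rfl⟩
      · rintro ⟨⟨hv, _⟩, rfl⟩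
        exact ⟨hv, rfl⟩
    · intro v hv
      simp only [coe_filter, mem_univ, true_and, Set.mem_ofPred_eq] at hv
      exact hv.2

/-- For S disjoint from R, the boundary lies in R exactly if no edge of G - R leaves S, which by
`hlab` means that S is a union of label classes. There are at most 2^n < b such sets, so the digits
do not overflow. -/
theorem avoiding_eq {n : ℕ} (G : SimpleGraph (Fin n)) (k : ℕ) (R : Finset (Fin n))
    (lab : Fin n → ℕ) {N b : ℕ} (hN : ∀ v, lab v < N) (hb : 2 ^ n < b)
    (hlab : ∀ S : Finset (Fin n),
      (∀ u v, u ∉ R → v ∉ R → G.Adj u v → (u ∈ S ↔ v ∈ S)) ↔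
      ∀ u v, u ∉ R → v ∉ R → lab u = lab v → (u ∈ S ↔ v ∈ S)) :
    (∏ l ∈ range N, (if #{v | v ∉ R ∧ lab v = l} = 0 then 1
      else 1 + b ^ #{v | v ∉ R ∧ lab v = l})) / b ^ k % b = avoiding G k R := by
  classical
  rw [prod_one_add_pow_class R lab b hN, sum_pow_card_div_mod, avoiding, filter_filter]
  · congr 1
    ext S
    simp only [mem_filter, mem_univ, true_and]
    rw [← hlab S, and_comm]
    refine and_congr_right fun _ => and_congr_right fun hS => ?_
    rw [disjoint_left] at hS
    constructor
    · intro h v hv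
      simp only [nbhd, mem_sdiff, mem_filter, mem_univ, true_and] at hv
      by_contra hR
      obtain ⟨u, hu, huv⟩ := hv.1.resolve_left hv.2
      exact hv.2 ((h u v (hS hu) hR huv).1 hu)
    · intro h
      have key : ∀ u v, v ∉ R → G.Adj u v → u ∈ S → v ∈ S := by
        intro u v hv huv hu
        by_contra hvS
        exact hv (h (by simpa [nbhd, hvS] using ⟨u, hu, huv⟩))
      exact fun u v hu hv huv => ⟨key u v hv huv, key v u hu huv.symm⟩
  · refine lt_of_le_of_lt (card_le_univ _) ?_
    rwa [Fintype.card_finset, Fintype.card_fin]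

theorem avoiding_le {n : ℕ} (G : SimpleGraph (Fin n)) (k : ℕ) (R : Finset (Fin n)) :
    avoiding G k R ≤ 2 ^ n := by
  refine (card_le_univ _).trans ?_
  rw [Fintype.card_finset, Fintype.card_fin]

/-! ### Enumeration of bounded-size sets through binary codes -/

/-- The set of the positions of the ones among the `n` lowest binary digits of `x`. -/
def bits (n x : ℕ) : Finset (Fin n) := {v | x / 2 ^ (v : ℕ) % 2 = 1}

theorem mem_bits {n x : ℕ} {v : Fin n} : v ∈ bits n x ↔ x / 2 ^ (v : ℕ) % 2 = 1 := by
  simp [bits]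

theorem mem_bits_iff_testBit {n x : ℕ} {v : Fin n} : v ∈ bits n x ↔ x.testBit v = true := by
  rw [mem_bits, Nat.testBit_eq_decide_div_mod_eq, decide_eq_true_eq]

theorem card_bits (n x : ℕ) : #(bits n x) = ∑ v ∈ range n, x / 2 ^ v % 2 := by
  rw [bits, card_filter, ← Fin.sum_univ_eq_sum_range (fun v => x / 2 ^ v % 2)]
  refine sum_congr rfl fun v _ => ?_
  split_ifs <;> omega

theorem bits_bijective (n : ℕ) : Function.Bijective fun x : Fin (2 ^ n) => bits n x := by
  rw [Fintype.bijective_iff_injective_and_card]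
  refine ⟨fun x y h => Fin.ext (Nat.eq_of_testBit_eq fun i => ?_), by simp⟩
  by_cases hi : i < n
  · have := congrArg (fun s : Finset (Fin n) => (⟨i, hi⟩ : Fin n) ∈ s) h
    simpa [mem_bits_iff_testBit] using this
  · have h1 : 2 ^ n ≤ 2 ^ i := Nat.pow_le_pow_right (by norm_num) (by omega)
    rw [Nat.testBit_lt_two_pow (x.2.trans_le h1), Nat.testBit_lt_two_pow (y.2.trans_le h1)]

theorem sum_bits {n : ℕ} (g : Finset (Fin n) → ℕ) :
    ∑ x ∈ range (2 ^ n), g (bits n x) = ∑ R, g R := by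
  rw [← Fin.sum_univ_eq_sum_range (fun x => g (bits n x))]
  exact (bits_bijective n).sum_comp g

/-- The nonzero digits of `d` fall on positions where `x` has zeros, so adding `d` only adds
elements. -/
theorem card_bits_lt {n x j d : ℕ} (hx : 2 ^ j ∣ x) (hd : d < 2 ^ j) (hd0 : 0 < d)
    (hn : x + d < 2 ^ n) : #(bits n x) < #(bits n (x + d)) := by
  obtain ⟨c, rfl⟩ := hx
  have h1 : ∀ i, (2 ^ j * c + d).testBit i = if i < j then d.testBit i else c.testBit (i - j) :=
    fun i => Nat.testBit_two_pow_mul_add c hd i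
  have h2 : ∀ i, (2 ^ j * c).testBit i = if i < j then false else c.testBit (i - j) := by
    intro i
    have := Nat.testBit_two_pow_mul_add c (Nat.two_pow_pos j) i
    simpa using this
  obtain ⟨i, hi⟩ := Nat.exists_testBit_of_ne_zero hd0.ne'
  have hij : i < j := by
    by_contra h
    have h3 : 2 ^ j ≤ 2 ^ i := Nat.pow_le_pow_right (by norm_num) (by omega)
    rw [Nat.testBit_lt_two_pow (hd.trans_le h3)] at hi
    exact Bool.false_ne_true hi
  have hin : i < n := by
    by_contra h
    have h3 : 2 ^ n ≤ 2 ^ i := Nat.pow_le_pow_right (by norm_num) (by omega)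
    rw [Nat.testBit_lt_two_pow (x := d) (by omega)] at hi
    exact Bool.false_ne_true hi
  refine card_lt_card (ssubset_iff_of_subset (fun v hv => ?_) |>.2 ⟨⟨i, hin⟩, ?_, ?_⟩)
  · rw [mem_bits_iff_testBit] at hv ⊢
    rw [h2] at hv
    rw [h1]
    split_ifs at hv ⊢
    exact hv
  · rw [mem_bits_iff_testBit, h1]
    simp [hij, hi]
  · rw [mem_bits_iff_testBit, h2]
    simp [hij]

theorem card_bits_succ (n x : ℕ) : #(bits (n + 1) x) = #(bits n (x / 2)) + x % 2 := by
  rw [card_bits, card_bits, sum_range_succ', pow_zero, Nat.div_one]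
  congr 1
  refine sum_congr rfl fun v _ => ?_
  rw [pow_succ, Nat.div_div_eq_div_mul, mul_comm]

/-- The summand `x % 2` records that an odd `x` produces a carry and gains no element. -/
theorem card_bits_add_one_le (n x : ℕ) : #(bits n (x + 1)) + x % 2 ≤ #(bits n x) + 1 := by
  induction n generalizing x with
  | zero =>
    simp only [card_bits, range_zero, sum_empty]
    omega
  | succ n ih =>
    rw [card_bits_succ, card_bits_succ]
    rcases Nat.mod_two_eq_zero_or_one x with h | h
    · rw [show (x + 1) / 2 = x / 2 by omega]
      omega
    · have := ih (x / 2)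
      rw [show (x + 1) / 2 = x / 2 + 1 by omega]
      omega

/-- The carry replaces a run of ones starting at position `j` by at most one digit. Dividing by 2
reduces this to odd `x`. -/
theorem card_bits_add_two_pow_le {n x j : ℕ} (hdvd : 2 ^ j ∣ x) (hx : x / 2 ^ j % 2 = 1) :
    #(bits n (x + 2 ^ j)) ≤ #(bits n x) := by
  induction j generalizing n x with
  | zero =>
    have := card_bits_add_one_le n x
    rw [pow_zero, Nat.div_one] at hx
    rw [pow_zero]
    omega
  | succ j ih =>
    cases n with
    | zero => simp [card_bits]
    | succ n =>
      obtain ⟨c, rfl⟩ := hdvd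
      have h1 : 2 ^ (j + 1) * c = 2 * (2 ^ j * c) := by ring
      have h2 : 2 ^ (j + 1) * c + 2 ^ (j + 1) = 2 * (2 ^ j * c + 2 ^ j) := by ring
      rw [Nat.mul_div_cancel_left _ (by positivity)] at hx
      rw [h2, h1, card_bits_succ, card_bits_succ, Nat.mul_div_cancel_left _ two_pos,
        Nat.mul_div_cancel_left _ two_pos, Nat.mul_mod_right, Nat.mul_mod_right]
      exact ih (dvd_mul_right _ _) (by rwa [Nat.mul_div_cancel_left _ (by positivity)])

/-- The sum of `g` over the sets of at most `l` elements that are encoded by numbers below `x`. -/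
def sumBelow {n : ℕ} (g : Finset (Fin n) → ℕ) (l x : ℕ) : ℕ :=
  ∑ y ∈ range x with #(bits n y) ≤ l, g (bits n y)

/-- The number of sets of at most `l` elements that are encoded by numbers not below `x`. -/
def remaining (n l x : ℕ) : ℕ := #{y ∈ Ico x (2 ^ n) | #(bits n y) ≤ l}

/-- `y` encodes the successor of the set encoded by `x`, among the sets of at most `l` elements. -/
structure IsNext (n l x y : ℕ) : Prop where
  lt : x < y
  le : y ≤ 2 ^ n
  card_le : #(bits n x) ≤ l
  card_le_next : y < 2 ^ n → #(bits n y) ≤ l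
  between : ∀ z, x < z → z < y → l < #(bits n z)

/-- Below the limit, adding 1 creates at most one more element. At the limit, all codes strictly
between `x` and `x + 2 ^ j` contain the set of `x` properly and are skipped, while the carry keeps
`x + 2 ^ j` within the limit. The case `j = n` is the empty set, from which the jump goes to the
end. -/
theorem isNext_ite {n l x j : ℕ} (hx : x < 2 ^ n) (hl : #(bits n x) ≤ l) (hj : j ≤ n)
    (hdvd : 2 ^ j ∣ x) (hbit : j = n ∨ x / 2 ^ j % 2 = 1) : IsNext n l x (if #(bits n x) < l then x + 1 else x + 2 ^ j) := by
  split_ifs with h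
  · have := card_bits_add_one_le n x
    exact ⟨by omega, by omega, hl, fun _ => by omega, fun z h1 h2 => by omega⟩
  · have hle : x + 2 ^ j ≤ 2 ^ n := by
      obtain ⟨c, rfl⟩ := hdvd
      obtain ⟨d, rfl⟩ := Nat.exists_eq_add_of_le hj
      rw [pow_add] at hx ⊢
      rw [← Nat.mul_succ]
      exact Nat.mul_le_mul_left _ (Nat.lt_of_mul_lt_mul_left hx)
    refine ⟨by have := Nat.two_pow_pos j; omega, hle, hl, fun h1 => ?_, fun z h1 h2 => ?_⟩
    · rcases hbit with rfl | hbit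
      · omega
      · exact (card_bits_add_two_pow_le hdvd hbit).trans hl
    have := card_bits_lt (n := n) (d := z - x) hdvd (by omega) (by omega) (by omega)
    rw [show x + (z - x) = z by omega] at this
    omega

theorem IsNext.sumBelow_eq {n l x y : ℕ} (h : IsNext n l x y) (g : Finset (Fin n) → ℕ) :
    sumBelow g l y = sumBelow g l x + g (bits n x) := by
  have : {z ∈ range y | #(bits n z) ≤ l} = insert x {z ∈ range x | #(bits n z) ≤ l} := by
    ext z
    simp only [mem_filter, mem_range, mem_insert]
    constructor
    · rintro ⟨h1, h2⟩
      rcases lt_trichotomy z x with h3 | h3 | h3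
      · exact Or.inr ⟨h3, h2⟩
      · exact Or.inl h3
      · exact absurd h2 (not_le.2 (h.between z h3 h1))
    · rintro (rfl | ⟨h1, h2⟩)
      · exact ⟨h.lt, h.card_le⟩
      · exact ⟨h1.trans h.lt, h2⟩
  rw [sumBelow, this, sum_insert (by simp), add_comm, sumBelow]

/-- The measure counts only codes within the limit, so skipped codes cost nothing; by
`remaining_zero` it starts at `binomDown n l`. -/
theorem IsNext.remaining_lt {n l x y : ℕ} (h : IsNext n l x y) :
    remaining n l y < remaining n l x := by
  refine card_lt_card (ssubset_iff_of_subset (fun z hz => ?_) |>.2 ⟨x, ?_, ?_⟩)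
  · simp only [mem_filter, mem_Ico] at hz ⊢
    exact ⟨⟨h.lt.le.trans hz.1.1, hz.1.2⟩, hz.2⟩
  · simp only [mem_filter, mem_Ico]
    exact ⟨⟨le_rfl, h.lt.trans_le h.le⟩, h.card_le⟩
  · simp only [mem_filter, mem_Ico]
    exact fun hz => absurd h.lt (not_lt.2 hz.1.1)

theorem sumBelow_two_pow {n : ℕ} (g : Finset (Fin n) → ℕ) (l : ℕ) :
    sumBelow g l (2 ^ n) = ∑ R with #R ≤ l, g R := by
  rw [sumBelow, sum_filter, sum_bits (fun R => if #R ≤ l then g R else 0), sum_filter]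

theorem sumBelow_le {n : ℕ} {g : Finset (Fin n) → ℕ} {b : ℕ} (hg : ∀ R, g R ≤ b) (l x : ℕ) :
    sumBelow g l x ≤ x * b := by
  refine (sum_le_card_nsmul _ _ b fun y _ => hg _).trans ?_
  rw [smul_eq_mul]
  exact Nat.mul_le_mul_right _ ((card_filter_le _ _).trans (card_range x).le)

theorem remaining_zero (n l : ℕ) : remaining n l 0 = binomDown n l := by
  rw [remaining, card_filter, ← range_eq_Ico,
    sum_bits (fun R : Finset (Fin n) => if #R ≤ l then 1 else 0), ← card_filter,
    card_eq_sum_card_fiberwise (f := card) (t := range (l + 1))]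
  · refine sum_congr rfl fun i hi => ?_
    have h2 := card_powersetCard i (univ : Finset (Fin n))
    rw [card_univ, Fintype.card_fin] at h2
    rw [← h2, powersetCard_eq_filter, powerset_univ, filter_filter]
    congr 1
    ext S
    simp only [mem_range] at hi
    simp only [mem_filter, mem_univ, true_and]
    omega
  · intro S hS
    simpa [Nat.lt_succ_iff] using hS

theorem binomDown_mono (n : ℕ) {l r : ℕ} (h : l ≤ r) : binomDown n l ≤ binomDown n r :=
  sum_le_sum_of_subset (range_subset_range.2 (by omega))

theorem binomDown_pos (n r : ℕ) : 0 < binomDown n r := by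
  refine lt_of_lt_of_le ?_ (binomDown_mono n (Nat.zero_le r))
  simp [binomDown]

/-! ### Decoding a set from its code -/

/-- The expression that reads a variable, which is cell `0` of an array of its own. -/
abbrev get (a : ℕ) : Expr := .read a (.const 0)

/-- Assignment to a variable. -/
abbrev put (a : ℕ) (e : Expr) : Block := .write a (.const 0) e

local infixr:60 " ;; " => Block.seq

/-- The absolute difference. -/
abbrev dist (x y : Expr) : Expr := .add (.sub x y) (.sub y x)

/-- Computes the digits, their sum, and the lowest power of two that occurs in the number `7`. -/
def decode : Block :=
  put 14 (.const 1) ;; put 12 (.const 0) ;; put 13 (.const 0) ;;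
  .each 16
    (.write 11 (get 16) (.mod (.div (get 7) (get 14)) (.const 2)) ;;
      .ite (.read 11 (get 16))
        (put 12 (.add (get 12) (.const 1)) ;; .ite (get 13) .skip (put 13 (get 14))) .skip ;;
      put 14 (.add (get 14) (get 14))) ;;
  .ite (get 13) .skip (put 13 (get 14))

theorem decode_wp {n B x : ℕ} {σ : State} (hn : σ 0 0 = n) (hx : σ 7 0 = x) (hB : n + 1 < B) :
    decode.wp B (fun τ => (∀ v : Fin n, τ 11 v = if v ∈ bits n x then 1 else 0) ∧
      τ 12 0 = #(bits n x) ∧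
      ∃ j ≤ n, τ 13 0 = 2 ^ j ∧ 2 ^ j ∣ x ∧ (j = n ∨ x / 2 ^ j % 2 = 1)) σ := by
  have hnB : n + 1 < 2 ^ B := hB.trans Nat.lt_two_pow_self
  have hpow : ∀ j ≤ n + 1, 2 ^ j < 2 ^ B := fun j hj => Nat.pow_lt_pow_right (by norm_num) (by omega)
  simp only [decode, Block.wp, Expr.val]
  -- The value 0 in cell `13` means that no one has been found yet; if this persists, the final test
  -- copies `2 ^ n` from cell `14`.
  refine ⟨by omega, by omega, by omega, fun j τ => (∀ v < j, τ 11 v = x / 2 ^ v % 2) ∧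
    τ 12 0 = ∑ v ∈ range j, x / 2 ^ v % 2 ∧ τ 14 0 = 2 ^ j ∧
    ((τ 13 0 = 0 ∧ 2 ^ j ∣ x) ∨
      ∃ i < j, τ 13 0 = 2 ^ i ∧ 2 ^ i ∣ x ∧ x / 2 ^ i % 2 = 1), ?_, ?_, ?_⟩
  · simp [State.set_apply]
  · simp only [State.set_apply]
    norm_num
    rintro j hj τ hτ h11 h12 h14 h13
    rw [hn] at hj
    have h7 : τ 7 0 = x := by rw [hτ 7 (by decide)]; simp [State.set_apply, hx]
    have hp := hpow j (by omega)
    have hp1 := hpow (j + 1) (by omega)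
    rw [pow_succ] at hp1
    have hsum : ∑ v ∈ range j, x / 2 ^ v % 2 ≤ j := by
      refine (sum_le_card_nsmul _ _ 1 fun v _ => by omega).trans ?_
      simp
    simp only [h7, h12, h14]
    have hmod : ∀ v ≤ j, (if v = j then x / 2 ^ j % 2 else τ 11 v) = x / 2 ^ v % 2 := by
      intro v hv
      split_ifs with h
      · rw [h]
      · exact h11 v (by omega)
    have hlow : τ 13 0 ≠ 0 ∨ x / 2 ^ j % 2 = 0 →
        (τ 13 0 = 0 ∧ 2 ^ (j + 1) ∣ x ∨
          ∃ i ≤ j, τ 13 0 = 2 ^ i ∧ 2 ^ i ∣ x ∧ x / 2 ^ i % 2 = 1) := by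
      intro h
      rcases h13 with ⟨h0, c, rfl⟩ | ⟨i, hi, hi'⟩
      · refine Or.inl ⟨h0, ?_⟩
        rw [Nat.mul_div_cancel_left _ (by positivity)] at h
        rw [pow_succ]
        exact mul_dvd_mul_left _ (Nat.dvd_of_mod_eq_zero (h.resolve_left fun h => h h0))
      · exact Or.inr ⟨i, hi.le, hi'⟩
    rw [pow_succ] at hlow
    rw [sum_range_succ, pow_succ]
    refine ⟨by omega, fun hbit => ?_, fun hbit => ?_⟩
    · refine ⟨by omega, fun h0 => ⟨by omega, hmod, by omega, by omega, hlow (Or.inl h0)⟩,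
        fun h0 => ⟨by omega, by omega, hmod, by omega, by omega, Or.inr ⟨j, le_rfl, rfl, ?_, hbit⟩⟩⟩
      rcases h13 with h13 | ⟨i, _, h13, _⟩
      · exact h13.2
      · rw [h13] at h0
        exact absurd h0 (by positivity)
    · exact ⟨by omega, hmod, by omega, by omega, hlow (Or.inr hbit)⟩
  · simp only [hn, State.set_apply]
    norm_num
    rintro τ hτ h11 h12 h14 h13
    have hbits : ∀ v : Fin n, τ 11 v = if v ∈ bits n x then 1 else 0 := by
      intro v
      have := h11 v v.2
      simp only [mem_bits]
      split_ifs <;> omega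
    rw [← card_bits] at h12
    have := hpow n (by omega)
    refine ⟨fun h0 => ⟨hbits, h12, ?_⟩, fun h0 => ⟨by omega, hbits, h12, n, le_rfl, h14, ?_, Or.inl rfl⟩⟩
    · obtain ⟨i, hi, h1, h2, h3⟩ := h13.resolve_left fun h => h0 h.1
      exact ⟨i, hi.le, h1, h2, Or.inr h3⟩
    · rcases h13 with h13 | ⟨i, _, h13, _⟩
      · exact h13.2
      · rw [h13] at h0
        exact absurd h0 (by positivity)

/-! ### Counting dominated vertices -/

theorem card_filter_lt_succ {n j : ℕ} (hj : j < n) (P : Fin n → Prop) [DecidablePred P] :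
    #{v : Fin n | v < j + 1 ∧ P v} =
      #{v : Fin n | v < j ∧ P v} + if P ⟨j, hj⟩ then 1 else 0 := by
  have h1 : ({v : Fin n | v < j + 1 ∧ P v} : Finset (Fin n)) =
      ({v : Fin n | v < j ∧ P v} : Finset (Fin n)) ∪
        ({v : Fin n | v = ⟨j, hj⟩ ∧ P v} : Finset (Fin n)) := by
    ext v
    simp only [mem_filter, mem_univ, true_and, mem_union, Fin.ext_iff, ← or_and_right]
    exact and_congr_left fun _ => by omega
  rw [h1, card_union_of_disjoint]
  · congr 1
    split_ifs with h
    · rw [card_eq_one]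
      refine ⟨⟨j, hj⟩, ?_⟩
      ext v
      simp only [mem_filter, mem_univ, true_and, mem_singleton, and_iff_left_iff_imp]
      rintro rfl
      exact h
    · rw [card_eq_zero, filter_eq_empty_iff]
      rintro v - ⟨rfl, hv⟩
      exact h hv
  · rw [disjoint_left]
    intro v hv hv'
    simp only [mem_filter, mem_univ, true_and, Fin.ext_iff] at hv hv'
    omega

theorem exists_lt_succ {n j : ℕ} (hj : j < n) (P : Fin n → Prop) :
    (∃ v : Fin n, v < j + 1 ∧ P v) ↔ (∃ v : Fin n, v < j ∧ P v) ∨ P ⟨j, hj⟩ := by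
  constructor
  · rintro ⟨v, hv, hP⟩
    rcases Nat.lt_succ_iff_lt_or_eq.1 hv with h | h
    · exact Or.inl ⟨v, h, hP⟩
    · exact Or.inr (by simpa [← h] using hP)
  · rintro (⟨v, hv, hP⟩ | hP)
    · exact ⟨v, hv.trans (Nat.lt_succ_self j), hP⟩
    · exact ⟨_, Nat.lt_succ_self j, hP⟩

open Classical in
/-- A state that holds the graph and the characteristic function of the set `R`. -/
structure Holds {n : ℕ} (G : SimpleGraph (Fin n)) (R : Finset (Fin n)) (σ : State) : Prop where
  size : σ 0 0 = n
  adj : ∀ u v : Fin n, σ 1 (u * n + v) = if G.Adj u v then 1 else 0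
  mem : ∀ v : Fin n, σ 11 v = if v ∈ R then 1 else 0

theorem Holds.congr {n : ℕ} {G : SimpleGraph (Fin n)} {R : Finset (Fin n)} {σ τ : State}
    (h : Holds G R σ) (h0 : τ 0 = σ 0) (h1 : τ 1 = σ 1) (h11 : τ 11 = σ 11) : Holds G R τ :=
  ⟨by rw [h0, h.size], fun u v => by rw [h1, h.adj], fun v => by rw [h11, h.mem]⟩

/-- Tests whether the vertex `17` belongs to the set and dominates the vertex `16`. -/
def dominates : Expr :=
  .mul (.read 11 (get 17)) (.add (.sub (.const 1) (dist (get 17) (get 16)))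
    (.read 1 (.add (.mul (get 17) (get 0)) (get 16))))

-- One minus the distance is an equality test. Its sum with the adjacency entry is at most 1 because
-- the graph has no loops.
open Classical in
theorem dominates_val {n i j : ℕ} {G : SimpleGraph (Fin n)} {R : Finset (Fin n)} {σ : State}
    (h : Holds G R σ) (hi : i < n) (hj : j < n) (h17 : σ 17 0 = i) (h16 : σ 16 0 = j) :
    dominates.val σ = if (⟨i, hi⟩ : Fin n) ∈ R ∧
      ((⟨i, hi⟩ : Fin n) = ⟨j, hj⟩ ∨ G.Adj ⟨i, hi⟩ ⟨j, hj⟩) then 1 else 0 := by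
  have h1 := h.adj ⟨i, hi⟩ ⟨j, hj⟩
  have h2 := h.mem ⟨i, hi⟩
  simp only at h1 h2
  simp only [dominates, Expr.val, h17, h16, h.size, h1, h2]
  by_cases hR : (⟨i, hi⟩ : Fin n) ∈ R
  · by_cases hij : i = j
    · subst hij
      simp [hR]
    · have : 1 - (i - j + (j - i)) = 0 := by omega
      simp [hR, hij, this]
  · simp [hR]

/-- Tests whether the vertex `16` is dominated. -/
def testDominated : Block :=
  put 19 (.const 0) ;; .each 17 (.ite dominates (put 19 (.const 1)) .skip)

open Classical in
theorem testDominated_wp {n B j : ℕ} {G : SimpleGraph (Fin n)} {R : Finset (Fin n)} {σ : State}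
    (h : Holds G R σ) (hB : n + 1 < B) (hj : j < n) (h16 : σ 16 0 = j) :
    testDominated.wp B (fun τ => τ 19 0 = if (⟨j, hj⟩ : Fin n) ∈ nbhd G R then 1 else 0) σ := by
  have hnB : n + 1 < 2 ^ B := hB.trans Nat.lt_two_pow_self
  refine ⟨by simp only [Expr.val]; omega, Block.wp_each (n := n) h.size (fun i ρ => ρ 19 0 =
    if ∃ u : Fin n, u < i ∧ u ∈ R ∧ (u = ⟨j, hj⟩ ∨ G.Adj u ⟨j, hj⟩) then 1 else 0) ?_ ?_ ?_⟩
  · simp [State.set_apply, Expr.val]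
  · intro i hi ρ hρ h19
    have hval := dominates_val (σ := ρ.set 17 0 i) (i := i) (j := j)
      (h.congr (hρ 0 (by decide)) (hρ 1 (by decide))
        (hρ 11 (by decide))) hi hj rfl
      (by rw [← h16]; exact congrFun (hρ 16 (by decide)) 0)
    simp only [exists_lt_succ hi, Block.wp, hval]
    refine ⟨fun hc => ⟨by simp only [Expr.val]; omega, ?_⟩, fun hc => ?_⟩
    · rw [if_pos (Or.inr (by by_contra h; exact hc (if_neg h)))]
      rfl
    · exact h19.trans (if_congr
        (or_iff_left fun h => one_ne_zero ((if_pos h).symm.trans hc)).symm rfl rfl)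
  · intro ρ hρ h19
    refine h19.trans (if_congr ?_ rfl rfl)
    simp only [nbhd, mem_filter, mem_univ, true_and, Fin.is_lt]
    constructor
    · rintro ⟨u, hu, rfl | huv⟩
      exacts [Or.inl hu, Or.inr ⟨u, hu, huv⟩]
    · rintro (hu | ⟨u, hu, huv⟩)
      exacts [⟨_, hu, Or.inl rfl⟩, ⟨u, hu, Or.inr huv⟩]

/-- Counts the dominated vertices. -/
def countDominated : Block :=
  put 20 (.const 0) ;; .each 16 (testDominated ;; put 20 (.add (get 20) (get 19)))

theorem countDominated_wp {n B : ℕ} {G : SimpleGraph (Fin n)} {R : Finset (Fin n)} {σ : State}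
    (h : Holds G R σ) (hB : n + 1 < B) :
    countDominated.wp B (fun τ => τ 20 0 = #(nbhd G R)) σ := by
  classical
  have hnB : n + 1 < 2 ^ B := hB.trans Nat.lt_two_pow_self
  have hle : ∀ j : ℕ, #{v : Fin n | v < j ∧ v ∈ nbhd G R} ≤ n := fun j =>
    (card_le_univ _).trans (Fintype.card_fin n).le
  refine ⟨by simp only [Expr.val]; omega, Block.wp_each (n := n) h.size
    (fun j τ => τ 20 0 = #{v : Fin n | v < j ∧ v ∈ nbhd G R}) ?_ ?_ ?_⟩
  · simp [State.set_apply, Expr.val]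
  · intro j hj τ hτ h20
    refine Block.wp_seq (testDominated_wp (σ := τ.set 16 0 j) (j := j)
      (h.congr (hτ 0 (by decide)) (hτ 1 (by decide))
        (hτ 11 (by decide))) hB hj rfl) fun ρ hρ h19 => ?_
    have h20' : ρ 20 0 = τ 20 0 := congrFun (hρ 20 (by decide)) 0
    have h3 : ρ 20 0 + ρ 19 0 = #{v : Fin n | v < j + 1 ∧ v ∈ nbhd G R} := by
      rw [card_filter_lt_succ hj, h20', h20, h19]
    have := hle (j + 1)
    exact ⟨by simp only [Expr.val]; omega, h3⟩
  · intro τ hτ h20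
    simpa [State.set_apply] using h20

/-! ### Labelling the components of G - R -/

/-- The labels describe the sets that respect the edges in `E` between vertices outside `R`. -/
def IsLabelling {n : ℕ} (R : Finset (Fin n)) (E : Fin n → Fin n → Prop) (lab : ℕ → ℕ) : Prop :=
  (∀ v < n, lab v < n) ∧ ∀ S : Finset (Fin n),
    (∀ u v, u ∉ R → v ∉ R → E u v → (u ∈ S ↔ v ∈ S)) ↔
    ∀ u v : Fin n, u ∉ R → v ∉ R → lab u = lab v → (u ∈ S ↔ v ∈ S)

theorem IsLabelling.congr {n : ℕ} {R : Finset (Fin n)} {E E' : Fin n → Fin n → Prop}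
    {lab : ℕ → ℕ} (h : IsLabelling R E lab)
    (hE : ∀ u v, u ∉ R → v ∉ R → (E u v ↔ E' u v)) : IsLabelling R E' lab := by
  refine ⟨h.1, fun S => ?_⟩
  rw [← h.2 S]
  exact forall₄_congr fun u v hu hv => by rw [hE u v hu hv]

/-- A new edge ab adds the condition a ∈ S ↔ b ∈ S, which amounts to fusing the two label classes.
Speaking only of the sets S that respect the edges avoids paths and components. -/
theorem IsLabelling.merge {n : ℕ} {R : Finset (Fin n)} {E : Fin n → Fin n → Prop}
    {lab lab' : ℕ → ℕ} (h : IsLabelling R E lab) {a b : Fin n} (ha : a ∉ R) (hb : b ∉ R)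
    (hlab : ∀ v < n, lab' v = if lab v = lab b then lab a else lab v) :
    IsLabelling R (fun u v => E u v ∨ (u = a ∧ v = b)) lab' := by
  refine ⟨fun v hv => ?_, fun S => ?_⟩
  · rw [hlab v hv]
    split_ifs
    exacts [h.1 a a.2, h.1 v hv]
  · have h1 : (∀ u v, u ∉ R → v ∉ R → (E u v ∨ (u = a ∧ v = b)) → (u ∈ S ↔ v ∈ S)) ↔
        (∀ u v, u ∉ R → v ∉ R → E u v → (u ∈ S ↔ v ∈ S)) ∧ (a ∈ S ↔ b ∈ S) := by
      constructor
      · exact fun H => ⟨fun u v hu hv huv => H u v hu hv (Or.inl huv), H a b ha hb (Or.inr ⟨rfl, rfl⟩)⟩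
      · rintro ⟨H, H'⟩ u v hu hv (huv | ⟨rfl, rfl⟩)
        exacts [H u v hu hv huv, H']
    rw [h1, h.2 S]
    constructor
    · rintro ⟨H, H'⟩ u v hu hv huv
      rw [hlab u u.2, hlab v v.2] at huv
      split_ifs at huv with h2 h3 h3
      · exact H u v hu hv (h2.trans h3.symm)
      · rw [H u b hu hb h2, ← H', H a v ha hv huv]
      · rw [H v b hv hb h3, ← H', H u a hu ha huv]
      · exact H u v hu hv huv
    · intro H
      refine ⟨fun u v hu hv huv => H u v hu hv ?_, H a b ha hb ?_⟩
      · rw [hlab u u.2, hlab v v.2, huv]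
      · rw [hlab a a.2, hlab b b.2, if_pos rfl, ite_self]

/-- Replaces the label `23` by the label `22`. -/
def relabel : Block :=
  .each 18 (.ite (dist (.read 21 (get 18)) (get 23)) .skip (.write 21 (get 18) (get 22)))

theorem relabel_wp {n B : ℕ} {σ : State} (hn : σ 0 0 = n) (hB : σ 22 0 < 2 ^ B) :
    relabel.wp B (fun τ => ∀ v < n, τ 21 v = if σ 21 v = σ 23 0 then σ 22 0 else σ 21 v) σ := by
  refine Block.wp_each hn (fun j τ => ∀ v, τ 21 v =
    if v < j then (if σ 21 v = σ 23 0 then σ 22 0 else σ 21 v) else σ 21 v) (by simp) ?_ ?_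
  · intro j hj τ hτ h21
    have h22 : τ 22 0 = σ 22 0 := by rw [hτ 22 (by decide)]
    have h23 : τ 23 0 = σ 23 0 := by rw [hτ 23 (by decide)]
    have hj21 := h21 j
    rw [if_neg (lt_irrefl j)] at hj21
    simp only [Block.wp, Expr.val, State.set_apply]
    norm_num [h22, h23, hj21]
    refine ⟨fun hc v => ?_, fun hc1 hc2 => ⟨hB, fun v => ?_⟩⟩
    · rw [h21 v]
      rcases eq_or_ne v j with rfl | hv
      · rw [if_neg (lt_irrefl v), if_pos le_rfl, if_neg (by omega)]
      · exact if_congr (by omega) rfl rfl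
    · rcases eq_or_ne v j with rfl | hv
      · rw [if_pos rfl, if_pos le_rfl, if_pos (by omega)]
      · rw [if_neg hv, h21 v]
        exact if_congr (by omega) rfl rfl
  · intro τ hτ h21 v hv
    have := h21 v
    rwa [if_pos hv] at this

/-- Tests whether the vertices `16` and `17` outside the set are adjacent. -/
def joined : Expr :=
  .mul (.mul (.read 1 (.add (.mul (get 16) (get 0)) (get 17)))
    (.sub (.const 1) (.read 11 (get 16)))) (.sub (.const 1) (.read 11 (get 17)))

open Classical in
theorem joined_val {n i j : ℕ} {G : SimpleGraph (Fin n)} {R : Finset (Fin n)} {σ : State}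
    (h : Holds G R σ) (hi : i < n) (hj : j < n) (h16 : σ 16 0 = i) (h17 : σ 17 0 = j) :
    joined.val σ = if G.Adj ⟨i, hi⟩ ⟨j, hj⟩ ∧ ⟨i, hi⟩ ∉ R ∧ ⟨j, hj⟩ ∉ R then 1 else 0 := by
  have h1 := h.adj ⟨i, hi⟩ ⟨j, hj⟩
  have h2 := h.mem ⟨i, hi⟩
  have h3 := h.mem ⟨j, hj⟩
  simp only at h1 h2 h3
  simp only [joined, Expr.val, h17, h16, h.size, h1, h2, h3]
  split_ifs <;> simp_all

/-- Merges the labels of the vertices `16` and `17` if they are joined. -/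
def mergePair : Block :=
  .ite joined (put 22 (.read 21 (get 16)) ;; put 23 (.read 21 (get 17)) ;; relabel) .skip

/-- Both labels are first copied to cells of their own, since `relabel` overwrites the array that
holds them. -/
theorem mergePair_wp {n B i j : ℕ} {G : SimpleGraph (Fin n)} {R : Finset (Fin n)} {σ : State}
    {E : Fin n → Fin n → Prop} (h : Holds G R σ) (hB : n + 1 < B) (hi : i < n) (hj : j < n)
    (h16 : σ 16 0 = i) (h17 : σ 17 0 = j) (hE : IsLabelling R E (σ 21)) :
    mergePair.wp B (fun τ => IsLabelling R
      (fun u v => E u v ∨ ((u : ℕ) = i ∧ (v : ℕ) = j) ∧ G.Adj u v) (τ 21)) σ := by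
  have hnB : n + 1 < 2 ^ B := hB.trans Nat.lt_two_pow_self
  classical
  have hval := joined_val h hi hj h16 h17
  have hi' := hE.1 i hi
  have hj' := hE.1 j hj
  refine ⟨fun hc => ?_, fun hc => ?_⟩
  · rw [hval, ite_ne_right_iff] at hc
    obtain ⟨⟨hadj, hiR, hjR⟩, -⟩ := hc
    refine ⟨?_, ?_, ?_⟩
    · simp only [Expr.val, h16]
      omega
    · simp only [Expr.val, State.set_apply]
      norm_num [h16, h17]
      omega
    · refine Block.wp_conseq (relabel_wp (n := n) h.size ?_) fun τ hτ h21 => ?_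
      · simp only [Expr.val, State.set_apply]
        norm_num [h16]
        omega
      · have := hE.merge hiR hjR (lab' := τ 21) fun v hv => by
          simpa [Expr.val, State.set_apply, h16, h17] using h21 v hv
        refine this.congr fun u v hu hv => or_congr_right ?_
        simp only [Fin.ext_iff]
        refine ⟨fun h => ⟨h, ?_⟩, fun h => h.1⟩
        rwa [show u = ⟨i, hi⟩ from Fin.ext h.1, show v = ⟨j, hj⟩ from Fin.ext h.2]
  · refine hE.congr fun u v hu hv => (or_iff_left ?_).symm
    rintro ⟨⟨rfl, rfl⟩, huv⟩
    rw [hval, if_pos ⟨huv, hu, hv⟩] at hc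
    exact one_ne_zero hc

/-- Computes labels for the components of the graph without the set `R`. -/
def label : Block :=
  .each 16 (.write 21 (get 16) (get 16)) ;; .each 16 (.each 17 mergePair)

theorem label_wp {n B : ℕ} {G : SimpleGraph (Fin n)} {R : Finset (Fin n)} {σ : State}
    (h : Holds G R σ) (hB : n + 1 < B) :
    label.wp B (fun τ => IsLabelling R G.Adj (τ 21)) σ := by
  have hnB : n + 1 < 2 ^ B := hB.trans Nat.lt_two_pow_self
  refine Block.wp_each (n := n) h.size (fun j τ => ∀ v < j, τ 21 v = v) (by simp) ?_ ?_
  · intro j hj τ _ hτ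
    simp only [Block.wp, Expr.val, State.set_apply]
    norm_num
    refine ⟨by omega, fun v hv => ?_⟩
    split_ifs with hvj
    · exact hvj.symm
    · exact hτ v (by omega)
  intro τ hτ h21
  replace h := h.congr (τ := τ.set 16 0 n) (hτ 0 (by decide))
    (hτ 1 (by decide)) (hτ 11 (by decide))
  replace h21 : ∀ v < n, τ.set 16 0 n 21 v = v := h21
  clear hτ
  generalize τ.set 16 0 n = τ at *
  -- The ordered pairs are processed lexicographically; the invariants restrict the edges to the
  -- pairs seen so far. The identity labelling fits the empty relation.
  refine Block.wp_each (n := n) h.size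
    (fun j τ => IsLabelling R (fun u v => u < j ∧ G.Adj u v) (τ 21)) ?_ ?_ ?_
  · refine ⟨fun v hv => by rwa [h21 v hv], fun S => ?_⟩
    simp only [Nat.not_lt_zero, false_and, false_imp_iff, implies_true, true_iff]
    intro u v _ _ huv
    rw [h21 u u.2, h21 v v.2] at huv
    rw [Fin.ext huv]
  · rintro j hj ρ hρ hI
    have hρ' := h.congr (τ := ρ.set 16 0 j) (hρ 0 (by decide)) (hρ 1 (by decide))
      (hρ 11 (by decide))
    refine Block.wp_each (n := n) hρ'.size (fun i ρ => IsLabelling R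
      (fun u v => (u < j ∨ ((u : ℕ) = j ∧ v < i)) ∧ G.Adj u v) (ρ 21)) ?_ ?_ ?_
    · exact hI.congr fun u v _ _ => by simp
    · rintro i hi χ hχ hI
      have hχ' := hρ'.congr (τ := χ.set 17 0 i) (hχ 0 (by decide)) (hχ 1 (by decide))
        (hχ 11 (by decide))
      refine Block.wp_conseq (mergePair_wp hχ' hB hj hi
        (by exact congrFun (hχ 16 (by decide)) 0) rfl hI) fun _ _ hE => hE.congr fun u v _ _ => ?_
      rw [← or_and_right]
      exact and_congr_left fun _ => by omega
    · exact fun χ _ hI => hI.congr fun u v _ _ => and_congr_left fun _ => by omega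
  · exact fun χ _ hI => hI.congr fun u v _ _ => and_iff_right u.2


/-! ### Evaluating the generating polynomial of unions of components -/

/-- Computes the power of the number `3` whose exponent is the size of the class with label `16`. -/
def classPower : Block :=
  put 14 (.const 1) ;;
  .each 17
    (.ite (.add (.read 11 (get 17)) (dist (.read 21 (get 17)) (get 16))) .skip
      (put 14 (.mul (get 14) (get 3))))

theorem classPower_wp {n B b l : ℕ} {G : SimpleGraph (Fin n)} {R : Finset (Fin n)} {σ : State}
    (h : Holds G R σ) (hb : σ 3 0 = b) (hb0 : 0 < b) (hB : b ^ n < 2 ^ B) (hl : σ 16 0 = l) :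
    classPower.wp B (fun τ => τ 14 0 = b ^ #{v : Fin n | v ∉ R ∧ σ 21 v = l}) σ := by
  have hpow : ∀ s : Finset (Fin n), b ^ #s < 2 ^ B := fun s =>
    (Nat.pow_le_pow_right hb0 ((card_le_univ s).trans (Fintype.card_fin n).le)).trans_lt hB
  refine ⟨by simpa [Expr.val] using (Nat.one_le_pow _ _ hb0).trans_lt hB,
    Block.wp_each (n := n) h.size
      (fun j τ => τ 14 0 = b ^ #{v : Fin n | v < j ∧ (v ∉ R ∧ σ 21 v = l)}) ?_ ?_ ?_⟩
  · simp [State.set_apply, Expr.val]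
  · intro j hj τ hτ h14
    have h3 : τ 3 0 = b := by rw [← hb]; exact congrFun (hτ 3 (by decide)) 0
    have h16 : τ 16 0 = l := by rw [← hl]; exact congrFun (hτ 16 (by decide)) 0
    have h21 : τ 21 j = σ 21 j := congrFun (hτ 21 (by decide)) j
    have h11 : τ 11 j = _ := (congrFun (hτ 11 (by decide)) j).trans (h.mem ⟨j, hj⟩)
    have hp := hpow {v : Fin n | v < j + 1 ∧ (v ∉ R ∧ σ 21 v = l)}
    rw [card_filter_lt_succ hj] at hp ⊢
    simp only [Block.wp, Expr.val, State.set_apply]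
    norm_num [h3, h16, h11, h21, h14]
    refine ⟨fun hc => ?_, fun hR hc1 hc2 => ?_⟩
    · rw [if_neg, add_zero]
      rintro ⟨h1, h2⟩
      have := hc h1
      omega
    · have h1 : σ 21 j = l := by omega
      rw [if_pos ⟨hR, h1⟩, pow_succ] at hp
      rw [if_pos ⟨hR, h1⟩, pow_succ]
      exact ⟨hp, rfl⟩
  · intro τ hτ h14
    simpa [State.set_apply] using h14

/-- The generating polynomial of the unions of classes, evaluated at `b`. -/
def classProd {n : ℕ} (R : Finset (Fin n)) (lab : ℕ → ℕ) (b j : ℕ) : ℕ :=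
  ∏ l ∈ range j, (if #{v : Fin n | v ∉ R ∧ lab v = l} = 0 then 1
    else 1 + b ^ #{v : Fin n | v ∉ R ∧ lab v = l})

/-- Partial products are bounded by the full one, a sum of at most 2^n powers `b ^ #S`. This bounds
the register during the multiplication. -/
theorem classProd_le {n : ℕ} {R : Finset (Fin n)} {lab : ℕ → ℕ} {b j : ℕ} (hb : 0 < b) (hj : j ≤ n)
    (hlab : ∀ v < n, lab v < n) : classProd R lab b j ≤ 2 ^ n * b ^ n := by
  calc classProd R lab b j ≤ classProd R lab b n := by
        refine prod_le_prod_of_subset_of_one_le' (range_subset_range.2 hj) fun l _ _ => ?_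
        split_ifs <;> omega
    _ = _ := prod_one_add_pow_class R (fun v => lab v) b fun v => hlab v v.2
    _ ≤ _ := by
        refine (sum_le_card_nsmul _ _ (b ^ n) fun S _ => ?_).trans ?_
        · exact Nat.pow_le_pow_right hb ((card_le_univ S).trans (Fintype.card_fin n).le)
        · rw [smul_eq_mul]
          refine Nat.mul_le_mul_right _ ((card_le_univ _).trans ?_)
          rw [Fintype.card_finset, Fintype.card_fin]

/-- Multiplies the contributions of the classes. -/
def classProduct : Block :=
  put 24 (.const 1) ;;
  .each 16 (classPower ;;
    .ite (.sub (get 14) (.const 1)) (put 24 (.mul (get 24) (.add (.const 1) (get 14)))) .skip)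

/-- As `b > 1`, a class is empty exactly if its power is 1, so testing the power minus 1 skips
unused labels. -/
theorem classProduct_wp {n B b : ℕ} {G : SimpleGraph (Fin n)} {R : Finset (Fin n)} {σ : State}
    (h : Holds G R σ) (hb : σ 3 0 = b) (hb0 : 1 < b) (hB : 2 ^ n * b ^ n < 2 ^ B)
    (hlab : ∀ v < n, σ 21 v < n) :
    classProduct.wp B (fun τ => τ 24 0 = classProd R (σ 21) b n) σ := by
  have hB' : b ^ n < 2 ^ B := (Nat.le_mul_of_pos_left _ (by positivity)).trans_lt hB
  refine ⟨by simpa [Expr.val] using (Nat.one_le_pow _ _ (by omega)).trans_lt hB',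
    Block.wp_each (n := n) h.size (fun j τ => τ 24 0 = classProd R (σ 21) b j) ?_ ?_ ?_⟩
  · simp [State.set_apply, Expr.val, classProd]
  · intro j hj τ hτ h24
    refine Block.wp_seq (classPower_wp (σ := τ.set 16 0 j) (b := b) (l := j)
      (h.congr (hτ 0 (by decide)) (hτ 1 (by decide)) (hτ 11 (by decide)))
      (by rw [← hb]; exact congrFun (hτ 3 (by decide)) 0) (by omega) hB' rfl) fun ρ hρ h14 => ?_
    have h21 : τ.set 16 0 j 21 = σ 21 := hτ 21 (by decide)
    have h24' : ρ 24 0 = τ 24 0 := congrFun (hρ 24 (by decide)) 0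
    have hle := (classProd_le (R := R) (j := j + 1) (by omega : 0 < b) hj hlab).trans_lt hB
    rw [h21] at h14
    rw [classProd, prod_range_succ, ← classProd] at hle ⊢
    simp only [Block.wp, Expr.val, h24', h24, h14]
    refine ⟨fun hc => ?_, fun hc => ?_⟩
    · rw [if_neg] at hle ⊢
      · exact ⟨hle, rfl⟩
      all_goals
        intro h0
        simp [h0] at hc
    · rw [if_pos, mul_one]
      by_contra h0
      have := Nat.one_lt_pow h0 hb0
      omega
  · intro τ hτ h24
    simpa [State.set_apply] using h24

/-! ### Contribution of a single set, and the loop body -/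

/-- The largest size of the sets that are enumerated. -/
def limit (k t : ℕ) : ℕ := if k ≤ t / 2 then k else t - 1 - k

/-- The contribution of a set that is added. -/
noncomputable def plus {n : ℕ} (G : SimpleGraph (Fin n)) (k t : ℕ) (R : Finset (Fin n)) : ℕ :=
  if k ≤ t / 2 then if #R = k ∧ t ≤ #(nbhd G R) then 1 else 0
  else if k < t ∧ (t - 1 - k - #R) % 2 = 1 then
    (n - k - #R - 1).choose (t - 1 - k - #R) * avoiding G k R else 0

/-- The contribution of a set that is subtracted. -/
noncomputable def minus {n : ℕ} (G : SimpleGraph (Fin n)) (k t : ℕ) (R : Finset (Fin n)) : ℕ :=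
  if k ≤ t / 2 then 0
  else if k < t ∧ (t - 1 - k - #R) % 2 = 0 then
    (n - k - #R - 1).choose (t - 1 - k - #R) * avoiding G k R else 0

/-- The machine has no negative numbers, so the weights are split by sign, according to the parity
of t-1-k-|R|, and the identity is written without subtraction. -/
theorem count_add_minus {n : ℕ} (G : SimpleGraph (Fin n)) {k t : ℕ} (ht : t ≤ n) :
    count G k t + ∑ R with #R ≤ limit k t, minus G k t R =
      (if k ≤ t / 2 then 0 else n.choose k) + ∑ R with #R ≤ limit k t, plus G k t R := by
  rcases Nat.lt_or_ge (t / 2) k with hk | hk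
  · rcases Nat.lt_or_ge k t with hkt | hkt
    · have h := count_add_sum G hkt ht
      have h1 : ∑ R : Finset (Fin n), weight (n - k) (t - 1 - k) #R * avoiding G k R =
          ∑ R with #R ≤ limit k t, ((minus G k t R : ℤ) - plus G k t R) := by
        rw [sum_filter]
        refine sum_congr rfl fun R _ => ?_
        rw [limit, if_neg (not_le.2 hk), weight]
        split_ifs with hR
        · rw [minus, plus, if_neg (not_le.2 hk), if_neg (not_le.2 hk)]
          rcases Nat.mod_two_eq_zero_or_one (t - 1 - k - #R) with h2 | h2
          · rw [(Nat.even_iff.2 h2).neg_one_pow, h2]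
            simp [hkt]
          · rw [(Nat.odd_iff.2 h2).neg_one_pow, h2]
            simp [hkt]
        · simp
      rw [h1, sum_sub_distrib] at h
      rw [if_neg (not_le.2 hk)]
      apply Int.natCast_inj.1
      push_cast
      linarith
    · have h1 : ∀ R, minus G k t R = 0 := fun R => by
        simp [minus, not_lt.2 hkt]
      have h2 : ∀ R, plus G k t R = 0 := fun R => by
        simp [plus, not_lt.2 hkt, not_le.2 hk]
      simp [h1, h2, not_le.2 hk, count_of_le G hkt]
  · rw [count_eq, card_filter, limit, if_pos hk, if_pos hk, sum_filter, sum_filter, zero_add,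
      ← sum_add_distrib]
    refine sum_congr rfl fun R _ => ?_
    rw [minus, plus, if_pos hk, if_pos hk, ite_self, add_zero]
    split_ifs <;> omega

theorem choose_mul_avoiding_le {n : ℕ} (G : SimpleGraph (Fin n)) (k a c : ℕ) (R : Finset (Fin n))
    (ha : a ≤ n) : a.choose c * avoiding G k R ≤ 2 ^ n * 2 ^ n :=
  Nat.mul_le_mul ((Nat.choose_le_two_pow a c).trans (Nat.pow_le_pow_right two_pos ha))
    (avoiding_le G k R)

theorem plus_le {n : ℕ} (G : SimpleGraph (Fin n)) (k t : ℕ) (R : Finset (Fin n)) :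
    plus G k t R ≤ 2 ^ n * 2 ^ n := by
  have : 0 < 2 ^ n * 2 ^ n := by positivity
  have := choose_mul_avoiding_le G k (n - k - #R - 1) (t - 1 - k - #R) R (by omega)
  rw [plus]
  split_ifs <;> omega

theorem minus_le {n : ℕ} (G : SimpleGraph (Fin n)) (k t : ℕ) (R : Finset (Fin n)) :
    minus G k t R ≤ 2 ^ n * 2 ^ n := by
  have := choose_mul_avoiding_le G k (n - k - #R - 1) (t - 1 - k - #R) R (by omega)
  rw [minus]
  split_ifs <;> omega

/-- The states in which the constants of the algorithm have been computed. -/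
structure Ready {n : ℕ} (G : SimpleGraph (Fin n)) (k t : ℕ) (σ : State) : Prop where
  size : σ 0 0 = n
  k_eq : σ 0 1 = k
  t_eq : σ 0 2 = t
  adj : σ 1 = input G k t 1
  factorial : ∀ i ≤ n, σ 2 i = i.factorial
  base : σ 3 0 = 2 ^ (n + 1)
  power : σ 4 0 = (2 ^ (n + 1)) ^ k
  limit : σ 5 0 = limit k t

theorem Ready.congr {n : ℕ} {G : SimpleGraph (Fin n)} {k t : ℕ} {σ τ : State} (h : Ready G k t σ)
    (hτ : ∀ a ≤ 5, τ a = σ a) : Ready G k t τ := by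
  constructor
  · rw [hτ 0 (by omega), h.size]
  · rw [hτ 0 (by omega), h.k_eq]
  · rw [hτ 0 (by omega), h.t_eq]
  · rw [hτ 1 (by omega), h.adj]
  · rw [hτ 2 (by omega)]
    exact h.factorial
  · rw [hτ 3 (by omega), h.base]
  · rw [hτ 4 (by omega), h.power]
  · rw [hτ 5 (by omega), h.limit]

theorem Ready.holds {n : ℕ} {G : SimpleGraph (Fin n)} {k t : ℕ} {R : Finset (Fin n)} {σ : State}
    (h : Ready G k t σ) (hR : ∀ v : Fin n, σ 11 v = if v ∈ R then 1 else 0) : Holds G R σ := by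
  classical
  refine ⟨h.size, fun u v => ?_, fun v => by rw [hR v]⟩
  rw [h.adj]
  simp only [input, one_ne_zero, if_false, if_true]
  refine if_congr ⟨?_, fun huv => ⟨u, v, rfl, huv⟩⟩ rfl rfl
  rintro ⟨u', v', h1, h2⟩
  have hn : 0 < n := u.pos
  have h3 : (u : ℕ) = u' := by
    have := congrArg (· / n) h1
    simpa [Nat.add_div_of_dvd_right, Nat.mul_div_cancel _ hn, Nat.div_eq_of_lt] using this
  have h4 : (v : ℕ) = v' := by
    rw [h3] at h1
    omega
  rwa [Fin.ext h3, Fin.ext h4]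

/-- The number `k`. -/
abbrev getK : Expr := .read 0 (.const 1)

/-- The number `t`. -/
abbrev getT : Expr := .read 0 (.const 2)

/-- Processes a set if `k ≤ t / 2`. -/
def processSmall : Block :=
  countDominated ;;
  .ite (.add (dist (get 12) getK) (.sub getT (get 20))) .skip (put 10 (.add (get 10) (.const 1)))

theorem processSmall_wp {n B k t : ℕ} {G : SimpleGraph (Fin n)} {R : Finset (Fin n)} {σ : State}
    (h : Ready G k t σ) (hR : Holds G R σ) (hB : n + 1 < B) (h12 : σ 12 0 = #R)
    (hk : k ≤ t / 2) (h10 : σ 10 0 + 1 < 2 ^ B) :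
    processSmall.wp B
      (fun τ => τ 9 0 = σ 9 0 + minus G k t R ∧ τ 10 0 = σ 10 0 + plus G k t R) σ := by
  refine Block.wp_seq (countDominated_wp hR hB) fun τ hτ h20 => ?_
  have e0 : τ 0 = σ 0 := hτ 0 (by decide)
  have e9 : τ 9 = σ 9 := hτ 9 (by decide)
  have e10 : τ 10 = σ 10 := hτ 10 (by decide)
  have e12 : τ 12 = σ 12 := hτ 12 (by decide)
  simp only [Block.wp, Expr.val, State.set_apply]
  norm_num [h20, e0, e9, e10, e12, h.k_eq, h.t_eq, h12, minus, plus, hk, h10]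
  refine ⟨fun hc h1 => ?_, fun hc1 hc2 hc3 => ?_⟩
  · by_contra h2
    exact hc (by omega) (by omega) (by omega)
  · exact ⟨by omega, by omega⟩

/-- Processes a set if `t / 2 < k < t`. -/
def processLarge : Block :=
  label ;; classProduct ;;
  put 26 (.mod (.div (get 24) (get 4)) (get 3)) ;;
  put 27 (.mul
    (.div (.read 2 (.sub (.sub (.sub (get 0) getK) (get 12)) (.const 1)))
      (.mul (.read 2 (.sub (get 5) (get 12)))
        (.read 2 (.sub (.sub (.sub (get 0) getK) (.const 1)) (get 5)))))
    (get 26)) ;;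
  .ite (.mod (.sub (get 5) (get 12)) (.const 2)) (put 10 (.add (get 10) (get 27)))
    (put 9 (.add (get 9) (get 27)))

theorem processLarge_wp {n B k t : ℕ} {G : SimpleGraph (Fin n)} {R : Finset (Fin n)} {σ : State}
    (h : Ready G k t σ) (hR : Holds G R σ) (hB : n + 1 < B) (hB2 : 2 ^ n * (2 ^ (n + 1)) ^ n < 2 ^ B)
    (h12 : σ 12 0 = #R) (hRl : #R ≤ limit k t) (ht : t ≤ n)
    (hk : t / 2 < k) (hkt : k < t) (h9 : σ 9 0 + 2 ^ n * 2 ^ n < 2 ^ B)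
    (h10 : σ 10 0 + 2 ^ n * 2 ^ n < 2 ^ B) :
    processLarge.wp B
      (fun τ => τ 9 0 = σ 9 0 + minus G k t R ∧ τ 10 0 = σ 10 0 + plus G k t R) σ := by
  refine Block.wp_seq (label_wp hR hB) fun τ hτ hlab => ?_
  have hR' := hR.congr (hτ 0 (by decide)) (hτ 1 (by decide)) (hτ 11 (by decide))
  have h' : Ready G k t τ := h.congr fun a ha => hτ a (by interval_cases a <;> decide)
  refine Block.wp_seq (classProduct_wp hR' h'.base (Nat.one_lt_two_pow (by omega)) hB2 hlab.1)
    fun ρ hρ h24 => ?_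
  have h'' : Ready G k t ρ := h'.congr fun a ha => hρ a (by interval_cases a <;> decide)
  have e9 : ρ 9 0 = σ 9 0 := by rw [hρ 9 (by decide), hτ 9 (by decide)]
  have e10 : ρ 10 0 = σ 10 0 := by rw [hρ 10 (by decide), hτ 10 (by decide)]
  have e12 : ρ 12 0 = #R := by rw [hρ 12 (by decide), hτ 12 (by decide), h12]
  have hl : limit k t = t - 1 - k := if_neg (not_le.2 hk)
  -- Digit `k` in base `2 ^ (n + 1)` of the product over the label classes.
  have hav : ρ 24 0 / ρ 4 0 % ρ 3 0 = avoiding G k R := by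
    rw [h24, h''.power, h''.base]
    exact avoiding_eq G k R (fun v => τ 21 v) (fun v => hlab.1 v v.2)
      (Nat.pow_lt_pow_right one_lt_two (Nat.lt_succ_self n)) hlab.2
  -- The quotient of factorials is a binomial coefficient because |R| ≤ t-1-k ≤ n-k-1.
  have hch : ρ 2 (n - k - #R - 1) / (ρ 2 (t - 1 - k - #R) * ρ 2 (n - k - 1 - (t - 1 - k))) =
      (n - k - #R - 1).choose (t - 1 - k - #R) := by
    rw [h''.factorial _ (by omega), h''.factorial _ (by omega), h''.factorial _ (by omega),
      Nat.choose_eq_factorial_div_factorial (by omega)]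
    congr 3
    omega
  have ha := avoiding_le G k R
  have hca := choose_mul_avoiding_le G k (n - k - #R - 1) (t - 1 - k - #R) R (by omega)
  have hn2 : 2 ^ n ≤ 2 ^ n * 2 ^ n := Nat.le_mul_of_pos_left _ (by positivity)
  simp only [Block.wp, Expr.val, State.set_apply]
  norm_num [hav, h''.size, h''.k_eq, h''.limit, hl, e12, e9, e10, hch]
  rw [hl] at hRl
  refine ⟨by omega, by omega, fun hc => ⟨by omega, ?_⟩, fun hc => ⟨by omega, ?_⟩⟩
  · simp [minus, plus, not_le.2 hk, hkt, hc]
  · simp [minus, plus, not_le.2 hk, hkt, hc]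


/-- Half of the number `t`. -/
abbrev getHalf : Expr := .div getT (.const 2)

/-- Processes a set. -/
def process : Block :=
  .ite (.sub getK getHalf) (.ite (.sub getT getK) processLarge .skip) processSmall

/-- Moves on to the next set. -/
def advance : Block :=
  .ite (.sub (get 5) (get 12)) (put 7 (.add (get 7) (.const 1))) (put 7 (.add (get 7) (get 13)))

/-- The body of the main loop. -/
def body : Block := decode ;; process ;; advance

/-- Numbers of `B` bits suffice for graphs with `n` vertices. -/
structure Suffices (n B : ℕ) : Prop where
  size : n + 1 < B
  factorial : n.factorial < 2 ^ B
  prod : 2 ^ n * (2 ^ (n + 1)) ^ n < 2 ^ B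
  sum : 2 ^ n * (2 ^ n * 2 ^ n) + 2 ^ n * 2 ^ n < 2 ^ B

/-- The largest exponents are n^2 for the factorial, n^2 + 2n for the product and 3n + 1 for the
sums; all stay below 4L + 4 because n ≤ n^2 ≤ L. -/
theorem suffices_of_sq_le {n L : ℕ} (h : n ^ 2 ≤ L) : Suffices n (4 * L + 4) := by
  have hn : n ≤ n ^ 2 := Nat.le_self_pow two_ne_zero n
  refine ⟨by omega, ?_, ?_, ?_⟩
  · calc n.factorial ≤ n ^ n := Nat.factorial_le_pow n
      _ ≤ (2 ^ n) ^ n := Nat.pow_le_pow_left Nat.lt_two_pow_self.le n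
      _ = 2 ^ (n ^ 2) := by rw [← pow_mul, sq]
      _ < _ := Nat.pow_lt_pow_right one_lt_two (by omega)
  · rw [← pow_mul, ← pow_add]
    exact Nat.pow_lt_pow_right one_lt_two (by nlinarith)
  · have h1 : 2 ^ n * 2 ^ n ≤ 2 ^ n * (2 ^ n * 2 ^ n) := Nat.le_mul_of_pos_left _ (by positivity)
    calc 2 ^ n * (2 ^ n * 2 ^ n) + 2 ^ n * 2 ^ n ≤ 2 ^ (n + (n + n) + 1) := by
          rw [pow_succ, pow_add, pow_add]
          omega
      _ < _ := Nat.pow_lt_pow_right one_lt_two (by omega)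

theorem process_wp {n B k t : ℕ} {G : SimpleGraph (Fin n)} {R : Finset (Fin n)} {σ : State}
    (hB : Suffices n B) (h : Ready G k t σ) (hR : Holds G R σ) (h12 : σ 12 0 = #R)
    (hRl : #R ≤ limit k t) (ht : t ≤ n) (h9 : σ 9 0 + 2 ^ n * 2 ^ n < 2 ^ B)
    (h10 : σ 10 0 + 2 ^ n * 2 ^ n < 2 ^ B) :
    process.wp B
      (fun τ => τ 9 0 = σ 9 0 + minus G k t R ∧ τ 10 0 = σ 10 0 + plus G k t R) σ := by
  have hpos : 0 < 2 ^ n * 2 ^ n := by positivity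
  refine ⟨fun hk => ⟨fun hkt => ?_, fun hkt => ?_⟩, fun hk => ?_⟩
  all_goals
    simp only [Expr.val, h.k_eq, h.t_eq] at hk
  · simp only [Expr.val, h.k_eq, h.t_eq] at hkt
    exact processLarge_wp h hR hB.size hB.prod h12 hRl ht (by omega) (by omega) h9 h10
  · simp only [Expr.val, h.k_eq, h.t_eq] at hkt
    have h1 : ¬ k ≤ t / 2 := by omega
    have h2 : ¬ k < t := by omega
    simp [Block.wp, minus, plus, h1, h2]
  · exact processSmall_wp h hR hB.size h12 (by omega) (by omega)

/-- Cell `7` holds the current code, cells `9` and `10` the subtracted and added totals of all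
smaller codes within the limit. -/
theorem body_wp {n B k t x : ℕ} {G : SimpleGraph (Fin n)} {σ : State}
    (hB : Suffices n B) (h : Ready G k t σ) (ht : t ≤ n) (hx : x < 2 ^ n)
    (hxl : #(bits n x) ≤ limit k t) (h7 : σ 7 0 = x)
    (h9 : σ 9 0 = sumBelow (minus G k t) (limit k t) x)
    (h10 : σ 10 0 = sumBelow (plus G k t) (limit k t) x) :
    body.wp B (fun τ => IsNext n (limit k t) x (τ 7 0) ∧
      τ 9 0 = sumBelow (minus G k t) (limit k t) (τ 7 0) ∧
      τ 10 0 = sumBelow (plus G k t) (limit k t) (τ 7 0)) σ := by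
  have h9le := sumBelow_le (minus_le G k t) (limit k t) x
  have h10le := sumBelow_le (plus_le G k t) (limit k t) x
  have hxle : x * (2 ^ n * 2 ^ n) ≤ 2 ^ n * (2 ^ n * 2 ^ n) := Nat.mul_le_mul_right _ hx.le
  have hsum := hB.sum
  refine Block.wp_seq (decode_wp h.size h7 hB.size) ?_
  rintro τ hτ ⟨h11, h12, j, hj, h13, hdvd, hbit⟩
  have h' : Ready G k t τ := h.congr fun a ha => hτ a (by interval_cases a <;> decide)
  have e9 : τ 9 0 = _ := (congrFun (hτ 9 (by decide)) 0).trans h9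
  have e10 : τ 10 0 = _ := (congrFun (hτ 10 (by decide)) 0).trans h10
  refine Block.wp_seq (process_wp hB h' (h'.holds h11) h12 hxl ht (by omega) (by omega)) ?_
  rintro ρ hρ ⟨i9, i10⟩
  have h'' : Ready G k t ρ := h'.congr fun a ha => hρ a (by interval_cases a <;> decide)
  have i7 : ρ 7 0 = x := by rw [hρ 7 (by decide), hτ 7 (by decide), h7]
  have i12 : ρ 12 0 = #(bits n x) := by rw [hρ 12 (by decide), h12]
  have i13 : ρ 13 0 = 2 ^ j := by rw [hρ 13 (by decide), h13]
  have hnext := isNext_ite hx hxl hj hdvd hbit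
  have hlt : 2 ^ n < 2 ^ B := Nat.pow_lt_pow_right one_lt_two (by have := hB.size; omega)
  have hle := hnext.le
  have s9 := hnext.sumBelow_eq (minus G k t)
  have s10 := hnext.sumBelow_eq (plus G k t)
  simp only [advance, Block.wp, Expr.val, State.set_apply]
  norm_num [i7, i12, i13, h''.limit]
  refine ⟨fun hc => ?_, fun hc => ?_⟩
  · rw [if_pos (by omega)] at hnext hle s9 s10
    exact ⟨by omega, hnext, by omega, by omega⟩
  · rw [if_neg (by omega)] at hnext hle s9 s10
    exact ⟨by omega, hnext, by omega, by omega⟩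

/-! ### Precomputed constants -/

/-- Computes the factorials. -/
def factorials : Block :=
  .write 2 (.const 0) (.const 1) ;;
  .each 16 (.write 2 (.add (get 16) (.const 1))
    (.mul (.read 2 (get 16)) (.add (get 16) (.const 1))))

theorem factorials_wp {n B : ℕ} {σ : State} (hB : Suffices n B) (hn : σ 0 0 = n) :
    factorials.wp B (fun τ => ∀ i ≤ n, τ 2 i = i.factorial) σ := by
  have hB1 : ∀ i ≤ n, i.factorial < 2 ^ B := fun i hi =>
    (Nat.factorial_le hi).trans_lt hB.factorial
  refine ⟨by simpa [Expr.val] using hB1 0 (by omega), Block.wp_each (n := n) hn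
    (fun j τ => ∀ i ≤ j, τ 2 i = i.factorial) ?_ ?_ ?_⟩
  · simp [State.set_apply, Expr.val]
  · intro j hj τ _ h2
    have hlt := hB1 (j + 1) (by omega)
    rw [Nat.factorial_succ, mul_comm] at hlt
    simp only [Block.wp, Expr.val, State.set_apply]
    norm_num [h2]
    refine ⟨hlt, fun i hi => ?_⟩
    split_ifs with h
    · rw [h, Nat.factorial_succ, mul_comm]
    · exact h2 i (by omega)
  · intro τ _ h2
    simpa [State.set_apply] using h2

/-- Computes `2 ^ n` and `2 ^ (n + 1)`. -/
def twoPowers : Block :=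
  put 8 (.const 1) ;; .each 16 (put 8 (.add (get 8) (get 8))) ;; put 3 (.add (get 8) (get 8))

theorem twoPowers_wp {n B : ℕ} {σ : State} (hB : Suffices n B) (hn : σ 0 0 = n) :
    twoPowers.wp B (fun τ => τ 8 0 = 2 ^ n ∧ τ 3 0 = 2 ^ (n + 1)) σ := by
  have hpow : ∀ j ≤ n + 1, 2 ^ j < 2 ^ B := fun j hj =>
    Nat.pow_lt_pow_right one_lt_two (by have := hB.size; omega)
  refine ⟨by simpa [Expr.val] using hpow 0 (by omega), Block.wp_each (n := n) hn
    (fun j τ => τ 8 0 = 2 ^ j) ?_ ?_ ?_⟩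
  · simp [State.set_apply, Expr.val]
  · intro j hj τ _ h8
    have := hpow (j + 1) (by omega)
    simp only [Block.wp, Expr.val, State.set_apply]
    norm_num [h8]
    omega
  · intro τ _ h8
    have := hpow (n + 1) le_rfl
    simp only [Block.wp, Expr.val, State.set_apply]
    norm_num [h8]
    omega

/-- Computes the power of the number `3` with exponent `k`. -/
def basePower : Block :=
  put 4 (.const 1) ;;
  .each 16 (.ite (.sub getK (get 16)) (put 4 (.mul (get 4) (get 3))) .skip)

theorem basePower_wp {n B b k : ℕ} {σ : State} (hn : σ 0 0 = n) (hσk : σ 0 1 = k) (hk : k ≤ n)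
    (hb : σ 3 0 = b) (hb0 : 0 < b) (hB : b ^ n < 2 ^ B) :
    basePower.wp B (fun τ => τ 4 0 = b ^ k) σ := by
  have hpow : ∀ j ≤ n, b ^ j < 2 ^ B := fun j hj => (Nat.pow_le_pow_right hb0 hj).trans_lt hB
  -- The loop always makes `n` passes, but multiplies only in the first `k` of them; hence the
  -- minimum.
  refine ⟨by simpa [Expr.val] using hpow 0 (by omega), Block.wp_each (n := n) hn
    (fun j τ => τ 4 0 = b ^ (min j k)) ?_ ?_ ?_⟩
  · simp [State.set_apply, Expr.val]
  · intro j hj τ hτ h4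
    have e3 : τ 3 0 = _ := (congrFun (hτ 3 (by decide)) 0).trans hb
    have e0 : τ 0 1 = _ := (congrFun (hτ 0 (by decide)) 1).trans hσk
    have hp := hpow (j + 1) (by omega)
    rw [pow_succ] at hp
    have hval : (Expr.sub getK (get 16)).val (τ.set 16 0 j) = k - j := by
      simp [Expr.val, State.set_apply, e0]
    refine ⟨fun hc => ?_, fun hc => ?_⟩
    · rw [hval] at hc
      rw [min_eq_left (by omega)] at h4 ⊢
      rw [pow_succ]
      simp [Block.wp, Expr.val, State.set_apply, h4, e3, hp]
    · rw [hval] at hc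
      rw [min_eq_right (by omega)] at h4 ⊢
      simpa [Block.wp, State.set_apply] using h4
  · intro τ _ h4
    rw [min_eq_right hk] at h4
    simpa [State.set_apply] using h4

/-- Computes the limit for the size of the sets and the initial summand. -/
def limits : Block :=
  .ite (.sub getK getHalf)
    (put 5 (.sub (.sub getT (.const 1)) getK) ;;
      put 6 (.div (.read 2 (get 0)) (.mul (.read 2 getK) (.read 2 (.sub (get 0) getK)))))
    (put 5 getK ;; put 6 (.const 0))

theorem limits_wp {n B k t : ℕ} {σ : State} (hB : Suffices n B) (hn : σ 0 0 = n)
    (hσk : σ 0 1 = k) (hσt : σ 0 2 = t) (hk : k ≤ n) (ht : t ≤ n)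
    (hf : ∀ i ≤ n, σ 2 i = i.factorial) :
    limits.wp B (fun τ => τ 5 0 = limit k t ∧
      τ 6 0 = if k ≤ t / 2 then 0 else n.choose k) σ := by
  have hnB : n < 2 ^ B := Nat.lt_two_pow_self.trans_le
    (Nat.pow_le_pow_right two_pos (by have := hB.size; omega))
  have hch : n.factorial / (k.factorial * (n - k).factorial) = n.choose k :=
    (Nat.choose_eq_factorial_div_factorial hk).symm
  have hchB : n.choose k < 2 ^ B := (Nat.choose_le_two_pow n k).trans_lt
    (Nat.pow_lt_pow_right one_lt_two (by have := hB.size; omega))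
  simp only [limits, Block.wp, Expr.val, State.set_apply]
  norm_num [hn, hσk, hσt, hf n le_rfl, hf k hk, hf (n - k) (by omega), hch, limit]
  exact ⟨fun hc => ⟨by omega, hchB, fun h => by omega, fun h => by omega⟩,
    fun hc => ⟨by omega, fun h => by omega, fun h => by omega⟩⟩

/-- Computes the constants of the algorithm. -/
def setup : Block := factorials ;; twoPowers ;; basePower ;; limits

theorem setup_wp {n B k t : ℕ} {G : SimpleGraph (Fin n)} (hB : Suffices n B) (hk : k ≤ n)
    (ht : t ≤ n) :
    setup.wp B (fun τ => Ready G k t τ ∧ τ 8 0 = 2 ^ n ∧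
      (τ 6 0 = if k ≤ t / 2 then 0 else n.choose k) ∧ τ 7 0 = 0 ∧ τ 9 0 = 0 ∧ τ 10 0 = 0)
      (input G k t) := by
  set σ := input G k t with hσ
  refine Block.wp_seq (factorials_wp hB (n := n) rfl) fun τ1 a1 h2 => ?_
  have b1 : τ1 0 = σ 0 := a1 0 (by decide)
  refine Block.wp_seq (twoPowers_wp hB (n := n) (by rw [b1]; rfl)) fun τ2 a2 h3 => ?_
  have b2 : τ2 0 = σ 0 := (a2 0 (by decide)).trans b1
  refine Block.wp_seq (basePower_wp (n := n) (k := k) (by rw [b2]; rfl) (by rw [b2]; rfl) hk h3.2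
    (by positivity) ((Nat.le_mul_of_pos_left _ (by positivity)).trans_lt hB.prod)) fun τ3 a3 h4 => ?_
  have b3 : τ3 0 = σ 0 := (a3 0 (by decide)).trans b2
  have c3 : τ3 2 = τ1 2 := (a3 2 (by decide)).trans (a2 2 (by decide))
  refine Block.wp_conseq (limits_wp hB (n := n) (k := k) (t := t) (by rw [b3]; rfl)
    (by rw [b3]; rfl) (by rw [b3]; rfl) hk ht (by rwa [c3])) fun τ4 a4 h5 => ?_
  have b4 : τ4 0 = σ 0 := (a4 0 (by decide)).trans b3
  have key : ∀ a, a = 7 ∨ a = 9 ∨ a = 10 → τ4 a 0 = 0 := by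
    rintro a (rfl | rfl | rfl)
    all_goals
      rw [a4 _ (by decide), a3 _ (by decide), a2 _ (by decide), a1 _ (by decide)]
      rfl
  refine ⟨⟨by rw [b4]; rfl, by rw [b4]; rfl, by rw [b4]; rfl, ?_, ?_, ?_, ?_, h5.1⟩, ?_, h5.2,
    key 7 (by simp), key 9 (by simp), key 10 (by simp)⟩
  · rw [a4 _ (by decide), a3 _ (by decide), a2 _ (by decide), a1 _ (by decide)]
  · rwa [a4 _ (by decide), c3]
  · rw [a4 _ (by decide), a3 _ (by decide), h3.2]
  · rw [a4 _ (by decide), h4]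
  · rw [a4 _ (by decide), a3 _ (by decide), h3.1]

/-- The source of ⌊t/2⌋: either k ≤ ⌊t/2⌋ is itself the limit, or k > ⌊t/2⌋ forces t-1-k ≤ ⌊t/2⌋. -/
theorem binomDown_limit_le (n k t : ℕ) : binomDown n (limit k t) ≤ binomDown n (t / 2) := by
  refine binomDown_mono n ?_
  rw [limit]
  split_ifs <;> omega

theorem input_bounded {n : ℕ} (G : SimpleGraph (Fin n)) (k t : ℕ) {B : ℕ} (hB : 0 < B)
    (hn : n.size ≤ B) (hk : k.size ≤ B) (ht : t.size ≤ B) : (input G k t).Bounded B := by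
  rw [Nat.size_le] at hn hk ht
  have h1 : 1 < 2 ^ B := Nat.one_lt_two_pow hB.ne'
  intro a i
  unfold input
  split_ifs <;> omega

/-! ### The main loop and the complete algorithm -/

/-- Test for the main loop. -/
def unfinished : Expr := .sub (get 8) (get 7)

/-- Sums up the contributions of all sets up to the limit. -/
def enumerate : Prog := .loop unfinished body.compile

theorem enumerate_halts {n B k t : ℕ} {G : SimpleGraph (Fin n)} {σ : State} (hσ : σ.Bounded B)
    (hB : Suffices n B) (ht : t ≤ n) (h : Ready G k t σ) (h8 : σ 8 0 = 2 ^ n) (h7 : σ 7 0 = 0)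
    (h9 : σ 9 0 = 0) (h10 : σ 10 0 = 0) :
    enumerate.Halts B
      (((unfinished.costBound + (1 + unfinished.sizeBound)).eval B * 2 + body.timeBound.eval B) *
        binomDown n (t / 2))
      (fun τ => τ 6 0 = σ 6 0 ∧ τ 9 0 = ∑ R with #R ≤ limit k t, minus G k t R ∧
        τ 10 0 = ∑ R with #R ≤ limit k t, plus G k t R) σ := by
  have hloop := Prog.halts_loop (B := B) (e := unfinished) (p := body.compile)
    (T := body.timeBound.eval B)
    (I := fun τ => Ready G k t τ ∧ τ 8 0 = 2 ^ n ∧ τ 6 0 = σ 6 0 ∧ τ 7 0 ≤ 2 ^ n ∧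
      (τ 7 0 < 2 ^ n → #(bits n (τ 7 0)) ≤ limit k t) ∧
      τ 9 0 = sumBelow (minus G k t) (limit k t) (τ 7 0) ∧
      τ 10 0 = sumBelow (plus G k t) (limit k t) (τ 7 0))
    (fun τ => remaining n (limit k t) (τ 7 0)) ?_ hσ
    ⟨h, h8, rfl, by omega, by simp [h7, card_bits], by simp [h7, h9, sumBelow],
      by simp [h7, h10, sumBelow]⟩
  · obtain ⟨u, τ, h1, h2, h3, ⟨-, i8, i6, i7, -, i9, i10⟩, h4⟩ := hloop
    have h5 : τ 7 0 = 2 ^ n := by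
      simp only [unfinished, Expr.val, i8] at h4
      omega
    rw [h5, sumBelow_two_pow] at i9 i10
    refine ⟨u, τ, h1, h2.trans ?_, h3, i6, i9, i10⟩
    rw [h7, remaining_zero]
    have h6 := binomDown_limit_le n k t
    have h7 := binomDown_pos n (limit k t)
    generalize Polynomial.eval B (unfinished.costBound + (1 + unfinished.sizeBound)) = c
    generalize Polynomial.eval B body.timeBound = d
    -- The final failing test is absorbed by doubling the test cost, as `binomDown` is positive.
    calc (binomDown n (limit k t) + 1) * c + binomDown n (limit k t) * d ≤
          (c * 2 + d) * binomDown n (limit k t) := by nlinarith [Nat.zero_le c]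
      _ ≤ _ := Nat.mul_le_mul_left _ h6
  · rintro τ hτ ⟨i, i8, i6, i7, il, i9, i10⟩ he
    have hlt : τ 7 0 < 2 ^ n := by
      simp only [unfinished, Expr.val, i8] at he
      omega
    refine Block.wp.halts (Block.wp_conseq (p := body)
      (body_wp hB i ht hlt (il hlt) rfl i9 i10) ?_) (by decide) hτ
      (by rw [i.size]; have := hB.size; omega)
    rintro ρ hρ ⟨j, j9, j10⟩
    refine ⟨⟨i.congr fun a ha => hρ a (by interval_cases a <;> decide), ?_, ?_, j.le,
      j.card_le_next, j9, j10⟩, j.remaining_lt⟩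
    · rw [hρ 8 (by decide), i8]
    · rw [hρ 6 (by decide), i6]

/-- Writes the result. -/
def result : Expr := .sub (.add (get 6) (get 10)) (get 9)

/-- Test for a trivial input. -/
def trivialInput : Expr := .add (.sub getK (get 0)) (.sub getT (get 0))

/-- The algorithm. -/
def algorithm : Prog :=
  .ite trivialInput (.write 0 (.const 0) (.const 0))
    (.seq setup.compile (.seq enumerate (.write 0 (.const 0) result)))

/-- If k or t exceeds n, the answer is 0. Treating this case first makes k, t ≤ n available for the
register bounds and the factorial table. -/
theorem algorithm_halts {n k t B : ℕ} (G : SimpleGraph (Fin n)) (hB : Suffices n B)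
    (hin : (input G k t).Bounded B) :
    algorithm.Halts B
      ((trivialInput.costBound + (1 + trivialInput.sizeBound)).eval B +
        ((Block.writeBound (.const 0) (.const 0)).eval B +
          (setup.timeBound.eval B +
            (((unfinished.costBound + (1 + unfinished.sizeBound)).eval B * 2 +
              body.timeBound.eval B) * binomDown n (t / 2) +
                (Block.writeBound (.const 0) result).eval B))))
      (fun τ => τ 0 0 = count G k t) (input G k t) := by
  have hval : trivialInput.val (input G k t) = (k - n) + (t - n) := rfl
  refine Prog.halts_ite hin (fun he => ?_) fun he => ?_
  · refine (Prog.halts_write hin (by simp [Expr.val]) ?_).mono (Nat.le_add_right _ _)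
    rw [count_eq_zero G (by omega)]
    rfl
  · have hk : k ≤ n := by omega
    have ht : t ≤ n := by omega
    refine Prog.Halts.mono ?_ (Nat.le_add_left _ _)
    refine Prog.Halts.seq (Block.wp.halts (setup_wp (G := G) hB hk ht) (by decide) hin
      (by have := hB.size; change n ≤ B; omega)) ?_
    rintro τ hτ ⟨h, h8, h6, h7, h9, h10⟩
    refine Prog.Halts.seq (enumerate_halts hτ hB ht h h8 h7 h9 h10) ?_
    rintro ρ hρ ⟨i6, i9, i10⟩
    have hcount := count_add_minus G (k := k) ht
    rw [← h6, ← i6, ← i9, ← i10] at hcount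
    have hres : result.val ρ = count G k t := by
      simp only [result, Expr.val]
      omega
    refine Prog.halts_write hρ ?_ ?_
    · rw [hres, count_eq]
      refine (Finset.card_le_univ _).trans_lt ?_
      rw [Fintype.card_finset, Fintype.card_fin]
      exact Nat.pow_lt_pow_right one_lt_two (by have := hB.size; omega)
    · rw [hres]
      rfl

theorem exists_algorithm :
    ∃ (p : Prog) (q : Polynomial ℕ),
      ∀ (n k t : ℕ) (G : SimpleGraph (Fin n)),
        ∃ (T : ℕ) (σ : State),
          Exec p (input G k t) T σ ∧
          σ 0 0 = count G k t ∧
          T ≤ q.eval (inputLength n k t) * binomDown n (t / 2) := by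
  -- All bounds are polynomials in the register length `B = 4 * L + 4`, hence the composition.
  refine ⟨algorithm, ((trivialInput.costBound + (1 + trivialInput.sizeBound)) +
    (Block.writeBound (.const 0) (.const 0) + (setup.timeBound +
      (((unfinished.costBound + (1 + unfinished.sizeBound)) * 2 + body.timeBound) +
        Block.writeBound (.const 0) result)))).comp (4 * Polynomial.X + 4), fun n k t G => ?_⟩
  set L := inputLength n k t with hL
  rw [inputLength] at hL
  have hpos := binomDown_pos n (t / 2)
  obtain ⟨T, τ, h1, h2, -, h3⟩ := algorithm_halts (k := k) (t := t) (B := 4 * L + 4) G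
    (suffices_of_sq_le (by omega))
    (input_bounded G k t (by omega) (by omega) (by omega) (by omega))
  refine ⟨T, τ, h1, h3, h2.trans ?_⟩
  simp only [Polynomial.eval_comp, Polynomial.eval_add, Polynomial.eval_mul, Polynomial.eval_X,
    Polynomial.eval_ofNat, Polynomial.eval_one, add_mul _ _ (binomDown n (t / 2))]
  -- The costs outside the main loop are multiplied by `binomDown`, which is at least 1.
  gcongr <;> exact Nat.le_mul_of_pos_right _ hpos

end DomSet

theorem mainTheorem5 :
    ∃ (p : RAM.Prog) (q : Polynomial ℕ),
      ∀ (n k t : ℕ) (G : SimpleGraph (Fin n)),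
        ∃ (T : ℕ) (σ : RAM.State),
          RAM.Exec p (DomSet.input G k t) T σ ∧
          σ 0 0 = DomSet.count G k t ∧
          T ≤ q.eval (DomSet.inputLength n k t) * DomSet.binomDown n (t / 2) :=
  DomSet.exists_algorithm
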